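/- Let $n\ge 2$ and let $V:\mathbb{R}^n\to\mathbb{C}$ be measurable. Write $\|f\|_{L^2(w)}=(\int_{\mathbb{R}^n}|f|^2w\,dx)^{1/2}$ for a weight $w$, with $|V|^{-1}=\infty$ where $V=0$ and $0\cdot\infty=0$. Let $R_0(z)=(-\Delta-z)^{-1}$ be the free resolvent on $L^2(\mathbb{R}^n)$, and suppose that for some constant $C(V)\ge 0$ the resolvent estimate $$\|R_0(z)f\|_{L^2(|V|)}\le C(V)\,\|f\|_{L^2(|V|^{-1})}$$ holds for all $z\in\mathbb{C}\setminus\mathbb{R}$ and all $f\in L^2\cap L^2(|V|^{-1})$. For $r>0$ let $d\sigma_r$ be the induced Lebesgue measure on the sphere $S_r^{n-1}=\{|\xi|=r\}$. Fix $\kappa>0$ and normalize the Fourier transform by $\widehat f(\xi)=\kappa\int_{\mathbb{R}^n}e^{-ix\cdot\xi}f(x)\,dx$, and likewise $\widehat{h\,d\sigma_r}(x)=\kappa\int_{S_r^{n-1}}e^{-ix\cdot\xi}h(\xi)\,d\sigma_r(\xi)$. For bounds $A,B\ge 0$ consider the estimates 1. $\|\widehat{d\sigma_r}*f\|_{L^2(|V|)}\le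 A\,\|f\|_{L^2(|V|^{-1})}$ for all $f\in L^2(|V|^{-1})$, the convolution integral being absolutely convergent at every point; 2. $\|\widehat f\|_{L^2(S_r^{n-1})}\le B\,\|f\|_{L^2(|V|^{-1})}$ for all $f\in L^2(|V|^{-1})$, where $f$ is locally integrable and $\widehat f|_{S_r^{n-1}}$ is the limit, which exists in $L^2(S_r^{n-1})$, of the Fourier transforms of the truncations $f\mathbf 1_{\{|x|<R\}}$ as $R\to\infty$ (it is given by the Fourier integral itself if $f\in L^1$); 3. $\|\widehat{h\,d\sigma_r}\|_{L^2(|V|)}\le B\,\|h\|_{L^2(S_r^{n-1})}$ for all $h\in L^2(S_r^{n-1})$. Then, for all $r>0$ and $\kappa>0$: (a) with $c_n=2(2\pi)^n/\pi$, the three estimates hold with $A=\kappa\,c_n\,r\,C(V)$ and $B=\kappa\,\bigl(c_n\,r\,C(V)\bigr)^{1/2}$; (b) if $\kappa\le(2\pi)^{-n}$, in particular for the normalization $\kappa=(2\pi)^{-n}$, they hold with $A=r\,C(V)$ and $B=r^{1/2}C(V)^{1/2}$; (c) the three estimates are equivalent: for every $D\ge 0$, estimate 1 with $A=\kappa D$,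 estimate 2 with $B=\kappa D^{1/2}$ and estimate 3 with $B=\kappa D^{1/2}$ are equivalent to one another. -/

import Mathlib

open MeasureTheory Filter Topology
open scoped ENNReal SchwartzMap Laplacian

namespace WeightedRestriction

noncomputable section

/-- Euclidean space `ℝⁿ`. -/
abbrev Rn (n : ℕ) : Type := EuclideanSpace ℝ (Fin n)

/-- The norm of `L²(w)`, i.e. `(∫ |f(x)|² w(x) dx)^{1/2}`, for a weight `w : ℝⁿ → [0, ∞]`
(with the convention `0 · ∞ = 0`). -/
def weightedNorm {n : ℕ} (w : Rn n → ℝ≥0∞) (f : Rn n → ℂ) : ℝ≥0∞ :=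
  (∫⁻ x, ‖f x‖ₑ ^ (2 : ℕ) * w x) ^ (1 / 2 : ℝ)

/-- The norm of `L²(|V|)`. -/
def normV {n : ℕ} (V : Rn n → ℂ) (f : Rn n → ℂ) : ℝ≥0∞ :=
  weightedNorm (fun x => ‖V x‖ₑ) f

/-- The norm of `L²(|V|⁻¹)`. Here `|V|⁻¹ = ∞` where `V = 0`, so that a function of finite norm
vanishes almost everywhere on `{V = 0}`. -/
def normVInv {n : ℕ} (V : Rn n → ℂ) (f : Rn n → ℂ) : ℝ≥0∞ :=
  weightedNorm (fun x => ‖V x‖ₑ⁻¹) f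

/-- `f ∈ L²(|V|⁻¹)`. -/
def MemVInv {n : ℕ} (V : Rn n → ℂ) (f : Rn n → ℂ) : Prop :=
  AEStronglyMeasurable f volume ∧ normVInv V f < ∞

/-- `u = R₀(z) f = (-Δ - z)⁻¹ f` on `L²(ℝⁿ)`: the functions `u, f` are in `L²` and
`-Δ u - z u = f` in the sense of (tempered) distributions. -/
def IsFreeResolvent {n : ℕ} (z : ℂ) (f u : Lp (α := Rn n) ℂ 2 volume) : Prop :=
  -(Δ (u : 𝓢'(Rn n, ℂ))) - z • (u : 𝓢'(Rn n, ℂ)) = (f : 𝓢'(Rn n, ℂ))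

/-- The resolvent estimate `‖R₀(z) f‖_{L²(|V|)} ≤ C ‖f‖_{L²(|V|⁻¹)}`, uniformly in
`z ∈ ℂ \ ℝ`, for `f` in `L² ∩ L²(|V|⁻¹)`. -/
def ResolventEstimate {n : ℕ} (V : Rn n → ℂ) (C : ℝ) : Prop :=
  ∀ z : ℂ, z.im ≠ 0 → ∀ f u : Lp (α := Rn n) ℂ 2 volume,
    MemVInv V f → IsFreeResolvent z f u → normV V u ≤ ENNReal.ofReal C * normVInv V f

/-- The induced Lebesgue measure `dσ_r` on the sphere of radius `r` about the origin, as a measure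
on `ℝⁿ`: the dilation by `r` of the surface measure of the unit sphere, times `r ^ (n - 1)`. -/
def sphereMeasure (n : ℕ) (r : ℝ) : Measure (Rn n) :=
  ENNReal.ofReal (r ^ (n - 1)) •
    ((volume : Measure (Rn n)).toSphere).map (fun ω : Metric.sphere (0 : Rn n) 1 => r • (ω : Rn n))

/-- The Fourier transform of the (complex) measure `f dμ`, with normalizing factor `κ`:
`ξ ↦ κ ∫ e^{-i x·ξ} f(x) dμ(x)`. -/
def fourierInt {n : ℕ} (κ : ℝ) (μ : Measure (Rn n)) (f : Rn n → ℂ) (ξ : Rn n) : ℂ :=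
  (κ : ℂ) * ∫ x, Complex.exp (-Complex.I * (inner ℝ x ξ : ℝ)) * f x ∂μ

/-- The Fourier transform of `dσ_r`. -/
def sphereHat (n : ℕ) (κ r : ℝ) : Rn n → ℂ :=
  fourierInt κ (sphereMeasure n r) (fun _ => 1)

/-- `g` is the restriction to the sphere of radius `r` of the Fourier transform of the locally
integrable function `f`: the limit in `L²(dσ_r)`, as `R → ∞`, of the Fourier transforms of
the truncations of `f` to the balls `B(0, R)`. -/
def IsFourierRestriction {n : ℕ} (κ r : ℝ) (f g : Rn n → ℂ) : Prop :=
  LocallyIntegrable f volume ∧ MemLp g 2 (sphereMeasure n r) ∧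
    Tendsto (fun R : ℝ =>
      eLpNorm (fun ξ => fourierInt κ volume ((Metric.ball (0 : Rn n) R).indicator f) ξ - g ξ) 2
        (sphereMeasure n r)) atTop (𝓝 0)

/-- The estimate for the convolution of `f` with the Fourier transform of `dσ_r`,
from `L²(|V|⁻¹)` to `L²(|V|)`, with bound `B`; the convolution integral converges absolutely at
every point. -/
def ConvolutionEstimate {n : ℕ} (κ : ℝ) (V : Rn n → ℂ) (r B : ℝ) : Prop :=
  ∀ f : Rn n → ℂ, MemVInv V f →
    ConvolutionExists (sphereHat n κ r) f (ContinuousLinearMap.mul ℂ ℂ) volume ∧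
    normV V (convolution (sphereHat n κ r) f (ContinuousLinearMap.mul ℂ ℂ) volume) ≤
      ENNReal.ofReal B * normVInv V f

/-- The estimate for the restriction of the Fourier transform of `f` to the sphere of radius `r`,
from `L²(|V|⁻¹)` to `L²(dσ_r)`, with bound `B`. Every `f ∈ L²(|V|⁻¹)` has such a
restriction, which is given by the Fourier integral itself if `f` is integrable. -/
def RestrictionEstimate {n : ℕ} (κ : ℝ) (V : Rn n → ℂ) (r B : ℝ) : Prop :=
  ∀ f : Rn n → ℂ, MemVInv V f →
    ∃ g : Rn n → ℂ, IsFourierRestriction κ r f g ∧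
      (Integrable f volume → g = fourierInt κ volume f) ∧
      eLpNorm g 2 (sphereMeasure n r) ≤ ENNReal.ofReal B * normVInv V f

/-- The estimate for the Fourier transform of `h dσ_r`, from `L²(dσ_r)` to `L²(|V|)`, with
bound `B`. -/
def ExtensionEstimate {n : ℕ} (κ : ℝ) (V : Rn n → ℂ) (r B : ℝ) : Prop :=
  ∀ h : Rn n → ℂ, MemLp h 2 (sphereMeasure n r) →
    normV V (fourierInt κ (sphereMeasure n r) h) ≤
      ENNReal.ofReal B * eLpNorm h 2 (sphereMeasure n r)

end

end WeightedRestriction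

/-! ### Weighted norms and their duality. -/

namespace WeightedRestriction

open scoped ComplexConjugate

variable {n : ℕ}

/-! Take z = l + iε with ε > 0. By Plancherel, Im ⟨f, R₀(z)f⟩ is the integral of |𝓕 f|² against the
Poisson kernel of width ε in the symbol of -Δ, centred at l. The resolvent estimate and
Cauchy-Schwarz between L²(|V|⁻¹) and L²(|V|) bound it by C‖f‖² (`ResolventEstimate.lintegral_le`).
For l = r² the kernel concentrates on the sphere of radius r as ε → 0, with limit π/(2r) dσ_r, and
Fatou in polar coordinates gives the restriction bound on L¹ ∩ L² (`lintegral_sphereMeasure_le`).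

The rest is a TT* argument. Restriction and extension are transposes of each other by the
multiplication formula `integral_fourierInt_mul`, and convolution with the transform of dσ_r is, up
to conjugations and a factor κ⁻¹, their composition (`convolution_sphereHat_eq`). The extension
estimate is the hub: each of the other two implies the weak form `IntegrableRestrictionEstimate`,
and duality against truncated test functions turns this into extension.

Conversely, extension applied to characters puts the translates of the transform of dσ_r in L²(|V|).
Since this transform is nonzero at the origin, V is locally integrable, and so is every f in
L²(|V|⁻¹). Truncations of f to balls are then integrable, and a limit over them gives the full
restriction and convolution estimates. -/

lemma weightedNorm_sq (w : Rn n → ℝ≥0∞) (f : Rn n → ℂ) :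
    weightedNorm w f ^ 2 = ∫⁻ x, ‖f x‖ₑ ^ 2 * w x := by
  rw [weightedNorm, ← ENNReal.rpow_natCast, ← ENNReal.rpow_mul]
  norm_num

lemma weightedNorm_le_iff_sq (w : Rn n → ℝ≥0∞) (f : Rn n → ℂ) (a : ℝ≥0∞) :
    weightedNorm w f ≤ a ↔ ∫⁻ x, ‖f x‖ₑ ^ 2 * w x ≤ a ^ 2 := by
  rw [← weightedNorm_sq]
  exact (ENNReal.pow_le_pow_left_iff two_ne_zero).symm

lemma weightedNorm_mono {w : Rn n → ℝ≥0∞} {f g : Rn n → ℂ} (h : ∀ x, ‖f x‖ₑ ≤ ‖g x‖ₑ) :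
    weightedNorm w f ≤ weightedNorm w g := by
  rw [weightedNorm_le_iff_sq, weightedNorm_sq]
  gcongr with x
  exact h x

lemma weightedNorm_const_mul (w : Rn n → ℝ≥0∞) (c : ℂ) (f : Rn n → ℂ) :
    weightedNorm w (fun x => c * f x) = ‖c‖ₑ * weightedNorm w f := by
  rcases eq_or_ne c 0 with rfl | hc
  · simp [weightedNorm]
  have : ∀ x, ‖c * f x‖ₑ ^ 2 * w x = ‖c‖ₑ ^ 2 * (‖f x‖ₑ ^ 2 * w x) := fun x => by
    rw [enorm_mul]; ring
  refine (ENNReal.pow_right_strictMono two_ne_zero).injective ?_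
  simp only [weightedNorm_sq, mul_pow, this]
  rw [lintegral_const_mul' _ _ (by finiteness)]

/-- A function of finite norm in `L²(|V|⁻¹)` vanishes almost everywhere where `V = 0`. -/
lemma MemVInv.ae_eq_zero {V f : Rn n → ℂ} (hV : AEMeasurable V volume) (hf : MemVInv V f) :
    ∀ᵐ x, V x = 0 → f x = 0 := by
  have h : ∫⁻ x, ‖f x‖ₑ ^ 2 * ‖V x‖ₑ⁻¹ ≠ ∞ := by
    have := hf.2
    rw [normVInv] at this
    rw [← weightedNorm_sq]
    finiteness
  filter_upwards [ae_lt_top' (by have := hf.1; fun_prop) h] with x hx hV0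
  by_contra hne
  simp [hV0, ENNReal.mul_top, hne] at hx

/-- The Cauchy-Schwarz inequality for the duality between `L²(|V|⁻¹)` and `L²(|V|)`. -/
lemma lintegral_mul_le_normVInv_mul_normV {V f u : Rn n → ℂ} (hV : AEMeasurable V volume)
    (hf : MemVInv V f) (hu : AEStronglyMeasurable u volume) :
    ∫⁻ x, ‖f x‖ₑ * ‖u x‖ₑ ≤ normVInv V f * normV V u := by
  have hfm := hf.1
  -- The product is split as (|f||V|^{-1/2})(|V|^{1/2}|u|). The weights cancel only where V ≠ 0;
  -- elsewhere f vanishes almost everywhere.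
  have key := ENNReal.lintegral_mul_le_Lp_mul_Lq volume Real.HolderConjugate.two_two
    (f := fun x => ‖f x‖ₑ * (‖V x‖ₑ ^ (1 / 2 : ℝ))⁻¹) (g := fun x => ‖V x‖ₑ ^ (1 / 2 : ℝ) * ‖u x‖ₑ)
    (by fun_prop) (by fun_prop)
  have hs : ∀ a : ℝ≥0∞, (a ^ (1 / 2 : ℝ)) ^ 2 = a := fun a => by
    rw [← ENNReal.rpow_natCast, ← ENNReal.rpow_mul]; norm_num
  calc ∫⁻ x, ‖f x‖ₑ * ‖u x‖ₑ
      = ∫⁻ x, ((fun x => ‖f x‖ₑ * (‖V x‖ₑ ^ (1 / 2 : ℝ))⁻¹) *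
          (fun x => ‖V x‖ₑ ^ (1 / 2 : ℝ) * ‖u x‖ₑ)) x := by
        refine lintegral_congr_ae ?_
        filter_upwards [hf.ae_eq_zero hV] with x hx
        rcases eq_or_ne (V x) 0 with h0 | h0
        · simp [hx h0]
        · have h1 : ‖V x‖ₑ ^ (1 / 2 : ℝ) ≠ 0 := by simp [h0]
          have h2 : ‖V x‖ₑ ^ (1 / 2 : ℝ) ≠ ∞ := by finiteness
          simp only [Pi.mul_apply]
          rw [mul_assoc, ← mul_assoc (_⁻¹), ENNReal.inv_mul_cancel h1 h2, one_mul]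
    _ ≤ _ := key
    _ = normVInv V f * normV V u := by
        simp only [normVInv, normV, weightedNorm, ENNReal.rpow_ofNat, mul_pow, hs,
          ← ENNReal.inv_pow]
        simp only [mul_comm]

lemma MemVInv.mono {V f g : Rn n → ℂ} (hf : MemVInv V f) (hg : AEStronglyMeasurable g volume)
    (h : ∀ x, ‖g x‖ₑ ≤ ‖f x‖ₑ) : MemVInv V g :=
  ⟨hg, (weightedNorm_mono h).trans_lt hf.2⟩

lemma MemVInv.conj {V f : Rn n → ℂ} (hf : MemVInv V f) : MemVInv V (fun x => conj (f x)) :=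
  hf.mono (Complex.continuous_conj.comp_aestronglyMeasurable hf.1) (by simp)

lemma normVInv_conj (V f : Rn n → ℂ) : normVInv V (fun x => conj (f x)) = normVInv V f := by
  simp [normVInv, weightedNorm]

/-! ### The sphere measure and Fourier integrals. -/

instance (r : ℝ) : IsFiniteMeasure (sphereMeasure n r) := by
  unfold sphereMeasure
  exact Measure.smul_finite _ ENNReal.ofReal_ne_top

lemma lintegral_sphereMeasure (r : ℝ) {f : Rn n → ℝ≥0∞} (hf : Measurable f) :
    ∫⁻ x, f x ∂(sphereMeasure n r) =
      ENNReal.ofReal (r ^ (n - 1)) *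
        ∫⁻ ω, f (r • (ω : Rn n)) ∂((volume : Measure (Rn n)).toSphere) := by
  rw [sphereMeasure, lintegral_smul_measure, lintegral_map hf (by fun_prop), smul_eq_mul]

lemma sphereMeasure_univ_ne_zero (hn : 1 ≤ n) {r : ℝ} (hr : 0 < r) :
    sphereMeasure n r Set.univ ≠ 0 := by
  have : Nonempty (Fin n) := ⟨⟨0, hn⟩⟩
  have : Nontrivial (Rn n) := by
    infer_instance
  rw [← lintegral_one, lintegral_sphereMeasure _ (by fun_prop)]
  simp [hr, -Measure.toSphere_apply_univ]

lemma norm_exp_inner (x ξ : Rn n) : ‖Complex.exp (-Complex.I * (inner ℝ x ξ : ℝ))‖ = 1 := by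
  rw [show -Complex.I * ((inner ℝ x ξ : ℝ) : ℂ) = ((-inner ℝ x ξ : ℝ) : ℂ) * Complex.I by
    push_cast; ring]
  exact Complex.norm_exp_ofReal_mul_I _

lemma integrable_exp_mul {μ : Measure (Rn n)} {f : Rn n → ℂ} (hf : Integrable f μ) (ξ : Rn n) :
    Integrable (fun x => Complex.exp (-Complex.I * (inner ℝ x ξ : ℝ)) * f x) μ := by
  refine hf.bdd_mul (c := 1) (by fun_prop) ?_
  exact .of_forall fun x => (norm_exp_inner x ξ).le

lemma continuous_fourierInt (κ : ℝ) {μ : Measure (Rn n)} {f : Rn n → ℂ} (hf : Integrable f μ) :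
    Continuous (fourierInt κ μ f) := by
  unfold fourierInt
  refine continuous_const.mul ?_
  refine continuous_of_dominated (bound := fun x => ‖f x‖)
    (fun ξ => (integrable_exp_mul hf ξ).1) (fun ξ => .of_forall fun x => ?_) hf.norm
    (.of_forall fun x => by fun_prop)
  rw [norm_mul, norm_exp_inner, one_mul]

lemma norm_fourierInt_le (κ : ℝ) (μ : Measure (Rn n)) (f : Rn n → ℂ) (ξ : Rn n) :
    ‖fourierInt κ μ f ξ‖ ≤ |κ| * ∫ x, ‖f x‖ ∂μ := by
  rw [fourierInt, norm_mul, Complex.norm_real, Real.norm_eq_abs]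
  gcongr
  refine (norm_integral_le_integral_norm _).trans_eq ?_
  simp only [norm_mul, norm_exp_inner, one_mul]

lemma memLp_fourierInt (κ : ℝ) {μ ν : Measure (Rn n)} [IsFiniteMeasure ν] {f : Rn n → ℂ}
    (hf : Integrable f μ) (p : ℝ≥0∞) : MemLp (fourierInt κ μ f) p ν :=
  .of_bound (continuous_fourierInt κ hf).aestronglyMeasurable _
    (.of_forall fun ξ => norm_fourierInt_le κ μ f ξ)

lemma fourierInt_sub (κ : ℝ) {μ : Measure (Rn n)} {f g : Rn n → ℂ} (hf : Integrable f μ)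
    (hg : Integrable g μ) (ξ : Rn n) :
    fourierInt κ μ f ξ - fourierInt κ μ g ξ = fourierInt κ μ (fun x => f x - g x) ξ := by
  simp only [fourierInt, mul_sub]
  rw [integral_sub (integrable_exp_mul hf ξ) (integrable_exp_mul hg ξ), mul_sub]

/-- The multiplication formula. -/
lemma integral_fourierInt_mul (κ : ℝ) {μ ν : Measure (Rn n)} [SFinite μ] [SFinite ν]
    {f g : Rn n → ℂ} (hf : Integrable f μ) (hg : Integrable g ν) :
    ∫ x, fourierInt κ μ f x * g x ∂ν = ∫ y, f y * fourierInt κ ν g y ∂μ := by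
  have hint : Integrable (fun p : Rn n × Rn n =>
      Complex.exp (-Complex.I * (inner ℝ p.2 p.1 : ℝ)) * (g p.1 * f p.2)) (ν.prod μ) := by
    refine (hg.mul_prod hf).bdd_mul (c := 1) (by fun_prop) (.of_forall fun p => ?_)
    exact (norm_exp_inner p.2 p.1).le
  have h1 : ∀ x, fourierInt κ μ f x * g x =
      κ * ∫ y, Complex.exp (-Complex.I * (inner ℝ y x : ℝ)) * (g x * f y) ∂μ := fun x => by
    rw [fourierInt, mul_assoc, ← integral_mul_const]
    congr 2; ext y; ring
  have h2 : ∀ y, f y * fourierInt κ ν g y =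
      κ * ∫ x, Complex.exp (-Complex.I * (inner ℝ y x : ℝ)) * (g x * f y) ∂ν := fun y => by
    rw [fourierInt, mul_left_comm, ← integral_const_mul]
    congr 2; ext x; rw [real_inner_comm]; ring
  simp only [h1, h2]
  rw [integral_const_mul, integral_const_mul, integral_integral_swap hint]

lemma conj_fourierInt (κ : ℝ) (μ : Measure (Rn n)) (f : Rn n → ℂ) (ξ : Rn n) :
    conj (fourierInt κ μ f ξ) = fourierInt κ μ (fun x => conj (f x)) (-ξ) := by
  simp only [fourierInt, map_mul, Complex.conj_ofReal, ← integral_conj, ← Complex.exp_conj]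
  simp

lemma norm_sphereHat_neg (κ r : ℝ) (x : Rn n) : ‖sphereHat n κ r (-x)‖ = ‖sphereHat n κ r x‖ := by
  rw [← RCLike.norm_conj (sphereHat n κ r x), sphereHat, conj_fourierInt]
  simp

/-- Modulation becomes translation. On the sphere, it exhibits the translates of `sphereHat` as
extensions of characters, to which the extension estimate applies. -/
lemma fourierInt_exp_mul (κ : ℝ) (μ : Measure (Rn n)) (f : Rn n → ℂ) (x y : Rn n) :
    fourierInt κ μ (fun ξ => Complex.exp (-Complex.I * (inner ℝ ξ x : ℝ)) * f ξ) y =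
      fourierInt κ μ f (x + y) := by
  simp only [fourierInt, ← mul_assoc, ← Complex.exp_add, inner_add_right]
  push_cast
  congr 3; ext ξ; ring_nf

lemma eLpNorm_two_sq (μ : Measure (Rn n)) (f : Rn n → ℂ) :
    eLpNorm f 2 μ ^ 2 = ∫⁻ x, ‖f x‖ₑ ^ 2 ∂μ := by
  rw [eLpNorm_eq_lintegral_rpow_enorm_toReal two_ne_zero ENNReal.ofNat_ne_top, ← ENNReal.rpow_natCast,
    ← ENNReal.rpow_mul]
  norm_num

lemma enorm_integral_mul_le (μ : Measure (Rn n)) {f g : Rn n → ℂ} (hf : AEStronglyMeasurable f μ)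
    (hg : AEStronglyMeasurable g μ) :
    ‖∫ x, f x * g x ∂μ‖ₑ ≤ eLpNorm f 2 μ * eLpNorm g 2 μ := by
  refine (enorm_integral_le_lintegral_enorm _).trans ?_
  have key := ENNReal.lintegral_mul_le_Lp_mul_Lq μ Real.HolderConjugate.two_two
    hf.enorm hg.enorm
  simpa [eLpNorm_eq_lintegral_rpow_enorm_toReal, enorm_mul] using key

lemma enorm_integral_ofReal {α : Type*} [MeasurableSpace α] {μ : Measure α} {g : α → ℝ}
    (hg : Integrable g μ) (h0 : ∀ x, 0 ≤ g x) :
    ‖∫ x, ((g x : ℝ) : ℂ) ∂μ‖ₑ = ∫⁻ x, ‖g x‖ₑ ∂μ := by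
  rw [integral_complex_ofReal, ← ofReal_norm, Complex.norm_real,
    Real.norm_of_nonneg (integral_nonneg h0), ofReal_integral_eq_lintegral_ofReal hg (.of_forall h0)]
  exact lintegral_congr fun x => (Real.enorm_of_nonneg (h0 x)).symm

/-- The closing step of the duality arguments: testing against the extremal function bounds a² by a
multiple of a. Cancelling a is legitimate only once a is known to be finite. -/
lemma le_mul_of_sq_le {a b c : ℝ≥0∞} (ha : a ≠ ∞) (h : a ^ 2 ≤ b * c * a) : a ≤ b * c := by
  rcases eq_or_ne a 0 with rfl | h0
  · simp
  · rw [sq] at h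
    exact (ENNReal.mul_le_mul_iff_left h0 ha).1 h

end WeightedRestriction

/-! ### Duality: from restriction to extension. -/

namespace WeightedRestriction

open scoped ComplexConjugate

variable {n : ℕ}

/-- Fatou's lemma, in the form used to pass each uniform bound to a limit. -/
lemma lintegral_le_of_tendsto_of_forall_le {α : Type*} [MeasurableSpace α] {μ : Measure α}
    {F : ℕ → α → ℝ≥0∞} {f : α → ℝ≥0∞} {K : ℝ≥0∞} (hF : ∀ k, AEMeasurable (F k) μ)
    (hlim : ∀ x, Tendsto (fun k => F k x) atTop (𝓝 (f x))) (hK : ∀ k, ∫⁻ x, F k x ∂μ ≤ K) :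
    ∫⁻ x, f x ∂μ ≤ K := by
  calc ∫⁻ x, f x ∂μ = ∫⁻ x, liminf (fun k => F k x) atTop ∂μ :=
        lintegral_congr fun x => (hlim x).liminf_eq.symm
    _ ≤ liminf (fun k => ∫⁻ x, F k x ∂μ) atTop := lintegral_liminf_le' hF
    _ ≤ K := liminf_le_of_frequently_le' (Frequently.of_forall hK)

/-- The restriction estimate for square integrable, integrable functions. -/
def IntegrableRestrictionEstimate (κ : ℝ) (V : Rn n → ℂ) (r B : ℝ) : Prop :=
  ∀ f : Rn n → ℂ, Integrable f volume → MemLp f 2 volume → MemVInv V f →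
    eLpNorm (fourierInt κ volume f) 2 (sphereMeasure n r) ≤ ENNReal.ofReal B * normVInv V f

lemma RestrictionEstimate.integrableRestrictionEstimate {κ r B : ℝ} {V : Rn n → ℂ}
    (h : RestrictionEstimate κ V r B) : IntegrableRestrictionEstimate κ V r B := by
  intro f hf _ hfV
  obtain ⟨g, -, hg, hB⟩ := h f hfV
  rwa [hg hf] at hB

/-- By duality, the restriction estimate implies the extension estimate. -/
lemma IntegrableRestrictionEstimate.extensionEstimate {κ r B : ℝ} {V : Rn n → ℂ}
    (hV : AEMeasurable V volume) (H : IntegrableRestrictionEstimate κ V r B) :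
    ExtensionEstimate κ V r B := by
  intro h hh
  have hhi : Integrable h (sphereMeasure n r) := hh.integrable one_le_two
  set u := fourierInt κ (sphereMeasure n r) h with hu
  have huc : Continuous u := continuous_fourierInt κ hhi
  -- A bounded, compactly supported truncation of |V|, equal to |V| at each point for large k. It
  -- makes the test function below lie in every Lᵖ without any integrability of V.
  let W : ℕ → Rn n → ℝ := fun k => (Metric.ball 0 k).indicator fun x => min ‖V x‖ k
  have hW0 : ∀ k x, 0 ≤ W k x := fun k x => Set.indicator_nonneg (fun x _ => by positivity) x
  have hWk : ∀ k x, W k x ≤ k := fun k x =>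
    Set.indicator_le' (fun x _ => min_le_right _ _) (fun x _ => by positivity) x
  have hWV : ∀ k x, W k x ≤ ‖V x‖ := fun k x =>
    Set.indicator_le' (fun x _ => min_le_left _ _) (fun x _ => by positivity) x
  have hWm : ∀ k, AEMeasurable (W k) volume := fun k =>
    (hV.norm.min aemeasurable_const).indicator measurableSet_ball
  have hWlim : ∀ x, Tendsto (fun k => W k x) atTop (𝓝 ‖V x‖) := by
    intro x
    refine tendsto_const_nhds.congr' ?_
    obtain ⟨N, hN⟩ := exists_nat_gt (max ‖x‖ ‖V x‖)
    filter_upwards [eventually_ge_atTop N] with k hk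
    have hk' : (N : ℝ) ≤ k := by exact_mod_cast hk
    have h1 : ‖x‖ < k := (le_max_left _ _).trans_lt (hN.trans_le hk')
    have h2 : ‖V x‖ < k := (le_max_right _ _).trans_lt (hN.trans_le hk')
    simp [W, h1, h2.le]
  have hbd : ∀ k, ∫⁻ x, ‖u x‖ₑ ^ 2 * ‖W k x‖ₑ ≤
      (ENNReal.ofReal B * eLpNorm h 2 (sphereMeasure n r)) ^ 2 := by
    intro k
    -- The extremal function for the duality: u f = |u|² W, while |f|²/|V| ≤ |u|² W because W ≤ |V|.
    let f : Rn n → ℂ := fun x => conj (u x) * W k x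
    have hfm : AEStronglyMeasurable f volume := by
      have := (hWm k).aestronglyMeasurable
      exact (Complex.continuous_conj.comp huc).aestronglyMeasurable.mul
        (Complex.continuous_ofReal.comp_aestronglyMeasurable this)
    have hfind : (Metric.ball 0 (k : ℝ)).indicator f = f := by
      refine Set.indicator_eq_self.2 fun x hx => ?_
      by_contra hxk
      exact hx (by simp only [f, W, Set.indicator_of_notMem hxk]; simp)
    have hftop : MemLp f ∞ volume := by
      refine memLp_top_of_bound hfm ((|κ| * ∫ x, ‖h x‖ ∂(sphereMeasure n r)) * k)
        (.of_forall fun x => ?_)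
      rw [norm_mul, RCLike.norm_conj, Complex.norm_real, Real.norm_of_nonneg (hW0 k x)]
      exact mul_le_mul (norm_fourierInt_le _ _ _ _) (hWk k x) (hW0 k x) (by positivity)
    have hfin : volume (Metric.ball (0 : Rn n) k) ≠ ∞ := measure_ball_lt_top.ne
    have hfp : ∀ p : ℝ≥0∞, MemLp f p volume := fun p => by
      rw [← hfind, memLp_indicator_iff_restrict measurableSet_ball]
      have : IsFiniteMeasure (volume.restrict (Metric.ball (0 : Rn n) k)) := ⟨by simpa using hfin.lt_top⟩
      exact (hftop.restrict _).mono_exponent le_top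
    have hfi : Integrable f volume := memLp_one_iff_integrable.1 (hfp 1)
    set a := weightedNorm (fun x => ‖W k x‖ₑ) u with ha
    have ha2 : a ^ 2 = ∫⁻ x, ‖u x‖ₑ ^ 2 * ‖W k x‖ₑ := weightedNorm_sq _ _
    have hnf : normVInv V f ≤ a := by
      rw [normVInv, weightedNorm_le_iff_sq, ha2]
      refine lintegral_mono fun x => ?_
      have h1 : ‖W k x‖ₑ ≤ ‖V x‖ₑ := by
        rw [enorm_le_iff_norm_le, Real.norm_of_nonneg (hW0 k x)]
        exact hWV k x
      have h2 : ‖W k x‖ₑ * ‖V x‖ₑ⁻¹ ≤ 1 :=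
        ENNReal.div_le_of_le_mul (by simpa using h1)
      have h3 : ‖f x‖ₑ = ‖u x‖ₑ * ‖W k x‖ₑ := by
        rw [enorm_mul, RCLike.enorm_conj]
        congr 1
        rw [enorm_eq_iff_norm_eq, Complex.norm_real]
      calc ‖f x‖ₑ ^ 2 * ‖V x‖ₑ⁻¹ = ‖u x‖ₑ ^ 2 * ‖W k x‖ₑ * (‖W k x‖ₑ * ‖V x‖ₑ⁻¹) := by
            rw [h3]; ring
        _ ≤ ‖u x‖ₑ ^ 2 * ‖W k x‖ₑ * 1 := by gcongr
        _ = _ := mul_one _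
    have hpt : ∀ x, u x * f x = ((‖u x‖ ^ 2 * W k x : ℝ) : ℂ) := fun x => by
      simp only [f]
      rw [← mul_assoc, Complex.mul_conj, Complex.normSq_eq_norm_sq]
      push_cast; rfl
    have hui : Integrable (fun x => u x * f x) volume :=
      hfi.bdd_mul huc.aestronglyMeasurable (.of_forall fun x => norm_fourierInt_le _ _ _ x)
    have hI : ‖∫ x, u x * f x‖ₑ = a ^ 2 := by
      rw [ha2]
      have hre : Integrable (fun x => ‖u x‖ ^ 2 * W k x) volume := by
        have := hui.re
        simpa [hpt, -Complex.ofReal_mul, -Complex.ofReal_pow] using this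
      simp only [hpt]
      rw [enorm_integral_ofReal hre fun x => mul_nonneg (by positivity) (hW0 k x)]
      refine lintegral_congr fun x => ?_
      rw [enorm_mul, enorm_pow, enorm_norm]
    -- By `hI`, a² is the norm of a complex number.
    have hafin : a ≠ ∞ := by
      intro h
      rw [h] at hI
      simp at hI
    have hfV : MemVInv V f := ⟨hfm, hnf.trans_lt hafin.lt_top⟩
    rw [← ha2]
    gcongr
    refine le_mul_of_sq_le hafin ?_
    rw [← hI, hu, integral_fourierInt_mul κ hhi hfi]
    calc _ ≤ eLpNorm h 2 (sphereMeasure n r) *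
            eLpNorm (fourierInt κ volume f) 2 (sphereMeasure n r) :=
          enorm_integral_mul_le _ hh.1 (continuous_fourierInt κ hfi).aestronglyMeasurable
      _ ≤ eLpNorm h 2 (sphereMeasure n r) * (ENNReal.ofReal B * a) := by
          gcongr
          exact (H f hfi (hfp 2) hfV).trans (by gcongr)
      _ = _ := by ring
  rw [normV, weightedNorm_le_iff_sq]
  refine lintegral_le_of_tendsto_of_forall_le (fun k => ?_) (fun x => ?_) hbd
  · have := hWm k
    have := huc.measurable
    fun_prop
  · refine ENNReal.Tendsto.const_mul ?_ (Or.inr (by finiteness))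
    have := ((hWlim x).enorm)
    simpa using this

/-! ### Consequences of the extension estimate. -/

section Extension

variable {κ r B : ℝ} {V : Rn n → ℂ}

lemma memLp_exp_neg (x : Rn n) (p : ℝ≥0∞) :
    MemLp (fun ξ : Rn n => Complex.exp (-Complex.I * (inner ℝ ξ x : ℝ))) p (sphereMeasure n r) :=
  .of_bound (by fun_prop) 1 (.of_forall fun ξ => (norm_exp_inner ξ x).le)

lemma continuous_sphereHat : Continuous (sphereHat n κ r) :=
  continuous_fourierInt κ (integrable_const 1)

/-- The extension estimate makes the translates of `sphereHat` square integrable with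
weight `|V|`. -/
lemma ExtensionEstimate.normV_sphereHat_lt_top (H : ExtensionEstimate κ V r B) (x : Rn n) :
    normV V (fun y => sphereHat n κ r (x - y)) < ∞ := by
  have h1 : ∀ y, sphereHat n κ r (-x + y) = fourierInt κ (sphereMeasure n r)
      (fun ξ => Complex.exp (-Complex.I * (inner ℝ ξ (-x) : ℝ))) y := fun y => by
    have := fourierInt_exp_mul κ (sphereMeasure n r) (fun _ => 1) (-x) y
    simp only [mul_one] at this
    rw [this]; rfl
  have h2 : normV V (fun y => sphereHat n κ r (x - y)) ≤ normV V (fourierInt κ (sphereMeasure n r)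
      (fun ξ => Complex.exp (-Complex.I * (inner ℝ ξ (-x) : ℝ)))) := by
    refine weightedNorm_mono fun y => ?_
    rw [← h1, enorm_le_iff_norm_le, ← norm_sphereHat_neg, neg_sub, neg_add_eq_sub]
  refine h2.trans_lt ((H _ (memLp_exp_neg _ _)).trans_lt ?_)
  exact ENNReal.mul_lt_top ENNReal.ofReal_lt_top (memLp_exp_neg _ _).eLpNorm_lt_top

/-- At the origin the phase is 1, so the value is κ times the total mass of the sphere. -/
lemma sphereHat_zero_ne_zero (hn : 1 ≤ n) (hκ : 0 < κ) (hr : 0 < r) : sphereHat n κ r 0 ≠ 0 := by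
  have : (sphereMeasure n r).real Set.univ ≠ 0 := by
    simpa [Measure.real, ENNReal.toReal_eq_zero_iff] using sphereMeasure_univ_ne_zero hn hr
  simpa [sphereHat, fourierInt, hκ.ne', measureReal_eq_zero_iff] using this

/-- The extension estimate forces `V` to be locally integrable. -/
lemma ExtensionEstimate.locallyIntegrable (hn : 1 ≤ n) (hκ : 0 < κ) (hr : 0 < r)
    (hV : AEMeasurable V volume) (H : ExtensionEstimate κ V r B) :
    LocallyIntegrable V volume := by
  intro x
  have h0 : 0 < ‖sphereHat n κ r 0‖ₑ := by simp [sphereHat_zero_ne_zero hn hκ hr]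
  -- Near x the translated transform stays above δ in modulus, so its finite L²(|V|) norm controls
  -- δ² times the local integral of |V|.
  obtain ⟨δ, hδ0, hδ⟩ := exists_between h0
  have hc : Continuous fun y => ‖sphereHat n κ r (x - y)‖ₑ :=
    (continuous_sphereHat.comp (by fun_prop)).enorm
  have hev : ∀ᶠ y in 𝓝 x, δ < ‖sphereHat n κ r (x - y)‖ₑ :=
    hc.continuousAt.eventually (lt_mem_nhds (by simpa using hδ))
  obtain ⟨s, hs, hso, hxs⟩ := eventually_nhds_iff.1 hev
  refine ⟨s, hso.mem_nhds hxs, hV.aestronglyMeasurable.restrict, ?_⟩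
  have h1 : ∫⁻ y in s, δ ^ 2 * ‖V y‖ₑ < ∞ := by
    calc ∫⁻ y in s, δ ^ 2 * ‖V y‖ₑ
        ≤ ∫⁻ y in s, ‖sphereHat n κ r (x - y)‖ₑ ^ 2 * ‖V y‖ₑ := by
          refine setLIntegral_mono' hso.measurableSet fun y hy => ?_
          gcongr
          exact (hs y hy).le
      _ ≤ ∫⁻ y, ‖sphereHat n κ r (x - y)‖ₑ ^ 2 * ‖V y‖ₑ := setLIntegral_le_lintegral _ _
      _ < ∞ := by
          rw [← weightedNorm_sq]
          exact ENNReal.pow_lt_top (H.normV_sphereHat_lt_top x)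
  have hδ2 : δ ^ 2 ≠ ∞ := ENNReal.pow_ne_top hδ.ne_top
  rw [lintegral_const_mul' _ _ hδ2] at h1
  exact ENNReal.lt_top_of_mul_ne_top_right h1.ne (by simp [hδ0.ne'])

/-- Cauchy-Schwarz against the indicator of s, whose squared L²(|V|) norm is the integral of |V|
over s. -/
lemma MemVInv.integrableOn {f : Rn n → ℂ} (hVm : AEMeasurable V volume) (hf : MemVInv V f)
    {s : Set (Rn n)} (hs : MeasurableSet s) (hV : IntegrableOn V s volume) :
    IntegrableOn f s volume := by
  refine ⟨hf.1.restrict, ?_⟩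
  have key := lintegral_mul_le_normVInv_mul_normV hVm hf (u := s.indicator fun _ => 1)
    (aestronglyMeasurable_const.indicator hs)
  have h1 : normV V (s.indicator fun _ => 1) < ∞ := by
    have : normV V (s.indicator fun _ => 1) ^ 2 < ∞ := by
      rw [normV, weightedNorm_sq]
      refine lt_of_le_of_lt (le_of_eq ?_) hV.2
      rw [← lintegral_indicator hs]
      refine lintegral_congr fun x => ?_
      by_cases hx : x ∈ s <;> simp [hx]
    exact (ENNReal.pow_lt_top_iff.1 this).resolve_right two_ne_zero
  refine lt_of_le_of_lt (le_of_eq ?_) (key.trans_lt (ENNReal.mul_lt_top hf.2 h1))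
  rw [← lintegral_indicator hs]
  refine lintegral_congr fun x => ?_
  by_cases hx : x ∈ s <;> simp [hx]

lemma MemVInv.locallyIntegrable {f : Rn n → ℂ} (hVm : AEMeasurable V volume)
    (hV : LocallyIntegrable V volume) (hf : MemVInv V f) : LocallyIntegrable f volume := by
  intro x
  obtain ⟨s, hs, hVs⟩ := hV x
  obtain ⟨t, hts, hto, hxt⟩ := mem_nhds_iff.1 hs
  exact ⟨t, hto.mem_nhds hxt, hf.integrableOn hVm hto.measurableSet (hVs.mono_set hts)⟩

/-- The restriction estimate for integrable functions, by duality. -/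
lemma ExtensionEstimate.eLpNorm_fourierInt_le (hV : AEMeasurable V volume)
    (H : ExtensionEstimate κ V r B) {f : Rn n → ℂ} (hf : Integrable f volume)
    (hfV : MemVInv V f) :
    eLpNorm (fourierInt κ volume f) 2 (sphereMeasure n r) ≤ ENNReal.ofReal B * normVInv V f := by
  have hm : MemLp (fourierInt κ volume f) 2 (sphereMeasure n r) := memLp_fourierInt κ hf 2
  -- Testing against the conjugate of the transform itself recovers the square of its L² norm.
  set g : Rn n → ℂ := fun ξ => conj (fourierInt κ volume f ξ)
  have hg : MemLp g 2 (sphereMeasure n r) := hm.star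
  have hgi : Integrable g (sphereMeasure n r) := hg.integrable one_le_two
  have hng : eLpNorm g 2 (sphereMeasure n r) =
      eLpNorm (fourierInt κ volume f) 2 (sphereMeasure n r) :=
    eLpNorm_congr_norm_ae (.of_forall fun x => by simp [g])
  refine le_mul_of_sq_le hm.eLpNorm_ne_top ?_
  have h1 : eLpNorm (fourierInt κ volume f) 2 (sphereMeasure n r) ^ 2 =
      ‖∫ ξ, fourierInt κ volume f ξ * g ξ ∂(sphereMeasure n r)‖ₑ := by
    have hpt : ∀ ξ, fourierInt κ volume f ξ * g ξ = ((‖fourierInt κ volume f ξ‖ ^ 2 : ℝ) : ℂ) :=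
      fun ξ => by rw [Complex.mul_conj, Complex.normSq_eq_norm_sq]
    simp only [hpt]
    rw [enorm_integral_ofReal hm.integrable_norm_pow' fun x => by positivity, eLpNorm_two_sq]
    refine lintegral_congr fun x => ?_
    rw [enorm_pow, enorm_norm]
  rw [h1, integral_fourierInt_mul κ hf hgi]
  calc _ ≤ ∫⁻ y, ‖f y * fourierInt κ (sphereMeasure n r) g y‖ₑ := enorm_integral_le_lintegral_enorm _
    _ = ∫⁻ y, ‖f y‖ₑ * ‖fourierInt κ (sphereMeasure n r) g y‖ₑ := by simp only [enorm_mul]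
    _ ≤ normVInv V f * normV V (fourierInt κ (sphereMeasure n r) g) :=
        lintegral_mul_le_normVInv_mul_normV hV hfV (continuous_fourierInt κ hgi).aestronglyMeasurable
    _ ≤ normVInv V f * (ENNReal.ofReal B * eLpNorm g 2 (sphereMeasure n r)) := by
        gcongr
        exact H g hg
    _ = _ := by rw [hng]; ring

end Extension

end WeightedRestriction

/-! ### Equivalence of the three estimates. -/

namespace WeightedRestriction

open scoped ComplexConjugate

variable {n : ℕ} {κ r B D : ℝ} {V : Rn n → ℂ}

/-- Dominated convergence: at each point the tail vanishes once the ball contains it. -/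
lemma MemVInv.tendsto_normVInv_indicator_compl {f : Rn n → ℂ} (hV : AEMeasurable V volume)
    (hf : MemVInv V f) :
    Tendsto (fun R : ℝ => normVInv V ((Metric.ball 0 R)ᶜ.indicator f)) atTop (𝓝 0) := by
  have hfm := hf.1
  have h : Tendsto (fun R : ℝ => ∫⁻ x, ‖(Metric.ball 0 R)ᶜ.indicator f x‖ₑ ^ 2 * ‖V x‖ₑ⁻¹) atTop
      (𝓝 (∫⁻ _ : Rn n, 0)) := by
    refine tendsto_lintegral_filter_of_dominated_convergence'
      (fun x => ‖f x‖ₑ ^ 2 * ‖V x‖ₑ⁻¹) (.of_forall fun R => ?_) (.of_forall fun R => ?_) ?_ ?_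
    · have := hfm.indicator (Metric.isOpen_ball (x := (0 : Rn n)) (ε := R)).measurableSet.compl
      fun_prop
    · refine .of_forall fun x => ?_
      gcongr
      exact Set.indicator_le_self' (s := (Metric.ball 0 R)ᶜ) (f := fun x => ‖f x‖ₑ)
        (fun _ _ => zero_le) x |>.trans_eq' (by
          by_cases hx : x ∈ (Metric.ball 0 R)ᶜ <;> simp only [Set.indicator, hx] <;> simp)
    · rw [← weightedNorm_sq]
      exact ENNReal.pow_ne_top hf.2.ne
    · refine .of_forall fun x => tendsto_const_nhds.congr' ?_
      filter_upwards [eventually_gt_atTop ‖x‖] with R hR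
      simp [hR]
  have h2 := (ENNReal.continuous_rpow_const (y := 1 / 2)).tendsto _ |>.comp h
  simpa [normVInv, weightedNorm, Function.comp_def] using h2

/-- The extension estimate implies the restriction estimate. -/
lemma ExtensionEstimate.restrictionEstimate (hn : 1 ≤ n) (hκ : 0 < κ) (hr : 0 < r)
    (hV : AEMeasurable V volume) (H : ExtensionEstimate κ V r B) :
    RestrictionEstimate κ V r B := by
  intro f hf
  have hloc : LocallyIntegrable f volume :=
    hf.locallyIntegrable hV (H.locallyIntegrable hn hκ hr hV)
  set F : ℝ → Rn n → ℂ := fun R => (Metric.ball 0 R).indicator f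
  have hFi : ∀ R, Integrable (F R) volume := fun R =>
    ((hloc.integrableOn_isCompact (isCompact_closedBall 0 R)).mono_set
      Metric.ball_subset_closedBall).integrable_indicator measurableSet_ball
  have hFV : ∀ R, MemVInv V (F R) := fun R =>
    hf.mono (hFi R).1 fun x => by by_cases hx : x ∈ Metric.ball 0 R <;> simp only [F, Set.indicator, hx] <;> simp
  have htail := hf.tendsto_normVInv_indicator_compl hV
  set T : ℝ → ℝ≥0∞ := fun R => normVInv V ((Metric.ball 0 R)ᶜ.indicator f)
  have hBT : Tendsto (fun R => ENNReal.ofReal B * T R) atTop (𝓝 0) := by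
    simpa using ENNReal.Tendsto.const_mul htail (Or.inr ENNReal.ofReal_ne_top)
  -- One tail bound serves twice: for two truncations it gives the Cauchy property, and for a
  -- truncation against an integrable f it gives convergence.
  have hdiff : ∀ f₁ f₂ : Rn n → ℂ, Integrable f₁ volume → Integrable f₂ volume → ∀ N : ℝ,
      (∀ x, ‖f₁ x - f₂ x‖ₑ ≤ ‖(Metric.ball 0 N)ᶜ.indicator f x‖ₑ) →
      eLpNorm (fun ξ => fourierInt κ volume f₁ ξ - fourierInt κ volume f₂ ξ) 2
        (sphereMeasure n r) ≤ ENNReal.ofReal B * T N := by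
    intro f₁ f₂ h₁ h₂ N hle
    have hV' : MemVInv V (fun x => f₁ x - f₂ x) := by
      refine hf.mono (h₁.sub h₂).1 fun x => (hle x).trans ?_
      by_cases hx : x ∈ (Metric.ball 0 N)ᶜ <;> simp only [Set.indicator, hx] <;> simp
    simp only [fourierInt_sub κ h₁ h₂]
    refine (H.eLpNorm_fourierInt_le hV (h₁.sub h₂) hV').trans ?_
    gcongr
    exact weightedNorm_mono hle
  obtain ⟨g, hg, hgi, hlim⟩ : ∃ g : Rn n → ℂ, MemLp g 2 (sphereMeasure n r) ∧
      (Integrable f volume → g = fourierInt κ volume f) ∧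
      Tendsto (fun R : ℝ => eLpNorm (fun ξ => fourierInt κ volume (F R) ξ - g ξ) 2
        (sphereMeasure n r)) atTop (𝓝 0) := by
    -- For integrable f the limit must equal the Fourier integral at every point, whereas
    -- completeness of L² yields only a class modulo null sets. Hence the separate case.
    by_cases hfi : Integrable f volume
    · refine ⟨fourierInt κ volume f, memLp_fourierInt κ hfi 2, fun _ => rfl, ?_⟩
      refine tendsto_of_tendsto_of_tendsto_of_le_of_le tendsto_const_nhds hBT
        (fun _ => zero_le) fun R => hdiff _ _ (hFi R) hfi R fun x => ?_
      by_cases hx : x ∈ Metric.ball 0 R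
      · simp only [F, Set.indicator_of_mem hx]; simp
      · simp only [F, Set.indicator_of_notMem hx, Set.indicator_of_mem (Set.mem_compl hx)]; simp
    · have hm : ∀ R, MemLp (fourierInt κ volume (F R)) 2 (sphereMeasure n r) := fun R =>
        memLp_fourierInt κ (hFi R) 2
      have hc : CauchySeq fun R => (hm R).toLp := by
        refine EMetric.cauchySeq_iff_le_tendsto_0.2
          ⟨fun R => ENNReal.ofReal B * T R, fun R S N hNR hNS => ?_, hBT⟩
        rw [Lp.edist_toLp_toLp]
        refine hdiff _ _ (hFi R) (hFi S) N fun x => ?_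
        by_cases hx : x ∈ Metric.ball 0 N
        · have h1 : x ∈ Metric.ball 0 R := Metric.ball_subset_ball hNR hx
          have h2 : x ∈ Metric.ball 0 S := Metric.ball_subset_ball hNS hx
          simp only [F, Set.indicator_of_mem h1, Set.indicator_of_mem h2]; simp
        · rw [Set.indicator_of_mem (Set.mem_compl hx)]
          by_cases h1 : x ∈ Metric.ball 0 R <;> by_cases h2 : x ∈ Metric.ball 0 S <;>
            simp only [F, Set.indicator, h1, h2] <;> simp
      obtain ⟨G, hG⟩ := cauchySeq_tendsto_of_complete hc
      refine ⟨G, Lp.memLp G, fun h => absurd h hfi, ?_⟩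
      refine (tendsto_iff_edist_tendsto_0.1 hG).congr fun R => ?_
      rw [Lp.edist_def]
      refine eLpNorm_congr_ae ?_
      filter_upwards [(hm R).coeFn_toLp] with ξ hξ
      simp [hξ]
  refine ⟨g, ⟨hloc, hg, hlim⟩, hgi, ?_⟩
  have hlim' := hlim.add_const (ENNReal.ofReal B * normVInv V f)
  rw [zero_add] at hlim'
  refine ge_of_tendsto hlim' (.of_forall fun R => ?_)
  have hcm : AEStronglyMeasurable (fourierInt κ volume (F R)) (sphereMeasure n r) :=
    (continuous_fourierInt κ (hFi R)).aestronglyMeasurable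
  calc eLpNorm g 2 (sphereMeasure n r)
      ≤ eLpNorm (g - fourierInt κ volume (F R)) 2 (sphereMeasure n r) +
          eLpNorm (fourierInt κ volume (F R)) 2 (sphereMeasure n r) := by
        have := eLpNorm_add_le (hg.1.sub hcm) hcm (p := 2) (by norm_num)
        simpa using this
    _ ≤ _ := by
        rw [eLpNorm_sub_comm]
        refine add_le_add le_rfl ((H.eLpNorm_fourierInt_le hV (hFi R) (hFV R)).trans ?_)
        gcongr
        exact weightedNorm_mono fun x => by
          by_cases hx : x ∈ Metric.ball 0 R <;> simp only [F, Set.indicator, hx] <;> simp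

/-- The TT* factorization. After y ↦ -y the kernel is the transform of a character on the sphere,
and the multiplication formula moves that transform onto f(-·). Both transforms on the right carry a
κ but the convolution only one, hence κ⁻¹. -/
lemma convolution_sphereHat_eq (hκ : κ ≠ 0) {f : Rn n → ℂ} (hf : Integrable f volume) (x : Rn n) :
    convolution (sphereHat n κ r) f (ContinuousLinearMap.mul ℂ ℂ) volume x =
      (κ : ℂ)⁻¹ * fourierInt κ (sphereMeasure n r)
        (fun ξ => conj (fourierInt κ volume (fun y => conj (f y)) ξ)) x := by
  have h1 : ∀ y, sphereHat n κ r (x + y) = fourierInt κ (sphereMeasure n r)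
      (fun ξ => Complex.exp (-Complex.I * (inner ℝ ξ x : ℝ))) y := fun y => by
    have := fourierInt_exp_mul κ (sphereMeasure n r) (fun _ => 1) x y
    simp only [mul_one] at this
    rw [this]; rfl
  have h2 : ∀ ξ, fourierInt κ volume (fun y => f (-y)) ξ =
      conj (fourierInt κ volume (fun y => conj (f y)) ξ) := fun ξ => by
    rw [conj_fourierInt]
    simp only [Complex.conj_conj, fourierInt]
    rw [← integral_neg_eq_self]
    simp
  calc convolution (sphereHat n κ r) f (ContinuousLinearMap.mul ℂ ℂ) volume x
      = ∫ y, sphereHat n κ r (x + y) * f (-y) := by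
        rw [convolution_eq_swap, ← integral_neg_eq_self]
        simp
    _ = ∫ ξ, Complex.exp (-Complex.I * (inner ℝ ξ x : ℝ)) *
          fourierInt κ volume (fun y => f (-y)) ξ ∂(sphereMeasure n r) := by
        simp only [h1]
        exact integral_fourierInt_mul κ ((memLp_exp_neg x 1).integrable le_rfl) hf.comp_neg
    _ = _ := by
        simp only [h2]
        rw [fourierInt, inv_mul_cancel_left₀ (by exact_mod_cast hκ)]

/-- The translated kernel lies in L²(|V|), so its pairing with f converges absolutely by
Cauchy-Schwarz. -/
lemma ExtensionEstimate.integrable_sphereHat_mul (hV : AEMeasurable V volume)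
    (H : ExtensionEstimate κ V r B) {f : Rn n → ℂ} (hf : MemVInv V f) (x : Rn n) :
    Integrable (fun y => sphereHat n κ r (x - y) * f y) volume := by
  have hm : AEStronglyMeasurable (fun y => sphereHat n κ r (x - y)) volume :=
    (continuous_sphereHat.comp (by fun_prop)).aestronglyMeasurable
  refine ⟨hm.mul hf.1, ?_⟩
  have h := lintegral_mul_le_normVInv_mul_normV hV hf hm
  refine lt_of_le_of_lt (le_of_eq ?_)
    (h.trans_lt (ENNReal.mul_lt_top hf.2 (H.normV_sphereHat_lt_top x)))
  exact lintegral_congr fun y => by rw [enorm_mul, mul_comm]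

/-- The extension estimate implies the convolution estimate. -/
lemma ExtensionEstimate.convolutionEstimate (hn : 1 ≤ n) (hκ : 0 < κ) (hr : 0 < r) (hD : 0 ≤ D)
    (hV : AEMeasurable V volume) (H : ExtensionEstimate κ V r (κ * √D)) :
    ConvolutionEstimate κ V r (κ * D) := by
  have hint : ∀ f : Rn n → ℂ, Integrable f volume → MemVInv V f →
      normV V (convolution (sphereHat n κ r) f (ContinuousLinearMap.mul ℂ ℂ) volume) ≤
        ENNReal.ofReal (κ * D) * normVInv V f := by
    intro f hf hfV
    have hfc : Integrable (fun y => conj (f y)) volume :=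
      (Complex.conjLIE.toContinuousLinearEquiv.integrable_comp_iff).2 hf
    set c := fourierInt κ volume (fun y => conj (f y))
    have hcm : MemLp (fun ξ => conj (c ξ)) 2 (sphereMeasure n r) := (memLp_fourierInt κ hfc 2).star
    have hcn : eLpNorm (fun ξ => conj (c ξ)) 2 (sphereMeasure n r) =
        eLpNorm c 2 (sphereMeasure n r) :=
      eLpNorm_congr_norm_ae (.of_forall fun x => by simp)
    rw [funext fun x => convolution_sphereHat_eq (r := r) hκ.ne' hf x, normV,
      weightedNorm_const_mul]
    -- Extension and restriction each cost κ√D, and κ⁻¹(κ√D)² = κD.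
    calc _ ≤ ‖(κ : ℂ)⁻¹‖ₑ * (ENNReal.ofReal (κ * √D) *
            (ENNReal.ofReal (κ * √D) * normVInv V (fun y => conj (f y)))) := by
          gcongr
          refine (H _ hcm).trans ?_
          rw [hcn]
          gcongr
          exact H.eLpNorm_fourierInt_le hV hfc hfV.conj
      _ = _ := by
          rw [normVInv_conj, ← mul_assoc, ← mul_assoc]
          congr 1
          rw [← ofReal_norm, norm_inv, Complex.norm_real, Real.norm_of_nonneg hκ.le,
            ← ENNReal.ofReal_mul (by positivity), ← ENNReal.ofReal_mul (by positivity)]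
          congr 1
          have := Real.mul_self_sqrt hD
          field_simp
          rw [sq, this]
  intro f hf
  refine ⟨fun x => convolutionExistsAt_iff_integrable_swap.2 (by
    simpa using H.integrable_sphereHat_mul hV hf x), ?_⟩
  have hloc : LocallyIntegrable f volume :=
    hf.locallyIntegrable hV (H.locallyIntegrable hn hκ hr hV)
  set F : ℕ → Rn n → ℂ := fun k => (Metric.ball 0 (k : ℝ)).indicator f
  have hFi : ∀ k, Integrable (F k) volume := fun k =>
    ((hloc.integrableOn_isCompact (isCompact_closedBall 0 (k : ℝ))).mono_set
      Metric.ball_subset_closedBall).integrable_indicator measurableSet_ball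
  have hFle : ∀ k x, ‖F k x‖ ≤ ‖f x‖ := fun k x => norm_indicator_le_norm_self _ _
  have hFle' : ∀ k x, ‖F k x‖ₑ ≤ ‖f x‖ₑ := fun k x => enorm_le_iff_norm_le.2 (hFle k x)
  have hFV : ∀ k, MemVInv V (F k) := fun k => hf.mono (hFi k).1 (hFle' k)
  have hlim : ∀ x, Tendsto (fun k => convolution (sphereHat n κ r) (F k)
      (ContinuousLinearMap.mul ℂ ℂ) volume x) atTop
      (𝓝 (convolution (sphereHat n κ r) f (ContinuousLinearMap.mul ℂ ℂ) volume x)) := by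
    intro x
    simp only [convolution_eq_swap, ContinuousLinearMap.mul_apply']
    refine tendsto_integral_of_dominated_convergence
      (fun y => ‖sphereHat n κ r (x - y) * f y‖)
      (fun k => (H.integrable_sphereHat_mul hV (hFV k) x).1)
      (H.integrable_sphereHat_mul hV hf x).norm (fun k => .of_forall fun y => ?_)
      (.of_forall fun y => ?_)
    · rw [norm_mul, norm_mul]
      gcongr
      exact hFle k y
    · refine tendsto_const_nhds.congr' ?_
      obtain ⟨N, hN⟩ := exists_nat_gt ‖y‖
      filter_upwards [eventually_ge_atTop N] with k hk
      have : ‖y‖ < k := hN.trans_le (by exact_mod_cast hk)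
      simp [F, this]
  rw [normV, weightedNorm_le_iff_sq]
  refine lintegral_le_of_tendsto_of_forall_le
    (F := fun k x => ‖convolution (sphereHat n κ r) (F k) (ContinuousLinearMap.mul ℂ ℂ) volume x‖ₑ ^ 2
      * ‖V x‖ₑ) (fun k => ?_) (fun x => ?_) fun k => ?_
  · have hm : Measurable (convolution (sphereHat n κ r) (F k)
        (ContinuousLinearMap.mul ℂ ℂ) volume) := by
      rw [funext fun x => convolution_sphereHat_eq (r := r) hκ.ne' (hFi k) x]
      have hfc : Integrable (fun y => conj (F k y)) volume :=
        (Complex.conjLIE.toContinuousLinearEquiv.integrable_comp_iff).2 (hFi k)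
      have hcm : MemLp (fun ξ => conj (fourierInt κ volume (fun y => conj (F k y)) ξ)) 1
        (sphereMeasure n r) := (memLp_fourierInt κ hfc 1).star
      exact (continuous_const.mul
        (continuous_fourierInt κ (memLp_one_iff_integrable.1 hcm))).measurable
    fun_prop
  · refine ENNReal.Tendsto.mul_const ?_ (Or.inr (by finiteness))
    exact (ENNReal.continuous_pow 2).tendsto _ |>.comp (hlim x).enorm
  · rw [← weightedNorm_le_iff_sq]
    refine (hint _ (hFi k) (hFV k)).trans ?_
    gcongr
    exact weightedNorm_mono (hFle' k)

/-- The convolution estimate implies the restriction estimate for integrable functions. -/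
lemma ConvolutionEstimate.integrableRestrictionEstimate (hκ : 0 < κ) (hD : 0 ≤ D)
    (hV : AEMeasurable V volume) (H : ConvolutionEstimate κ V r (κ * D)) :
    IntegrableRestrictionEstimate κ V r (κ * √D) := by
  intro f hf _ hfV
  have hκ' : (κ : ℂ) ≠ 0 := by exact_mod_cast hκ.ne'
  have hfc : Integrable (fun y => conj (f y)) volume :=
    (Complex.conjLIE.toContinuousLinearEquiv.integrable_comp_iff).2 hf
  set c := fourierInt κ volume f with hc
  have hcm : MemLp c 2 (sphereMeasure n r) := memLp_fourierInt κ hf 2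
  have hcc : Integrable (fun ξ => conj (c ξ)) (sphereMeasure n r) :=
    hcm.star.integrable one_le_two
  set v := convolution (sphereHat n κ r) (fun y => conj (f y))
    (ContinuousLinearMap.mul ℂ ℂ) volume with hv
  have hveq : ∀ x, κ * v x = fourierInt κ (sphereMeasure n r) (fun ξ => conj (c ξ)) x := fun x => by
    rw [hv, convolution_sphereHat_eq hκ.ne' hfc, mul_inv_cancel_left₀ hκ']
    simp [hc]
  have hvm : AEStronglyMeasurable v volume := by
    have : v = fun x => (κ : ℂ)⁻¹ *
        fourierInt κ (sphereMeasure n r) (fun ξ => conj (c ξ)) x := by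
      ext x
      rw [← hveq, inv_mul_cancel_left₀ hκ']
    rw [this]
    exact (continuous_const.mul (continuous_fourierInt κ hcc)).aestronglyMeasurable
  -- The converse half of TT*: the squared norm of the restriction is κ times the pairing of f with
  -- the convolution of its conjugate. The final constant is κ · κD = (κ√D)².
  have h1 : eLpNorm c 2 (sphereMeasure n r) ^ 2 = ‖∫ x, (κ * v x) * f x‖ₑ := by
    simp only [hveq]
    rw [integral_fourierInt_mul κ hcc hf, ← hc]
    have hpt : ∀ ξ, conj (c ξ) * c ξ = ((‖c ξ‖ ^ 2 : ℝ) : ℂ) :=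
      fun ξ => by rw [mul_comm, Complex.mul_conj, Complex.normSq_eq_norm_sq]
    simp only [hpt]
    rw [enorm_integral_ofReal hcm.integrable_norm_pow' fun x => by positivity, eLpNorm_two_sq]
    refine lintegral_congr fun x => ?_
    rw [enorm_pow, enorm_norm]
  rw [← ENNReal.pow_le_pow_left_iff two_ne_zero, h1]
  calc _ ≤ ∫⁻ x, ‖(κ * v x) * f x‖ₑ := enorm_integral_le_lintegral_enorm _
    _ = ENNReal.ofReal κ * ∫⁻ x, ‖f x‖ₑ * ‖v x‖ₑ := by
        rw [← lintegral_const_mul' _ _ ENNReal.ofReal_ne_top]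
        refine lintegral_congr fun x => ?_
        rw [enorm_mul, enorm_mul, ← ofReal_norm (κ : ℂ), Complex.norm_real,
          Real.norm_of_nonneg hκ.le]
        ring
    _ ≤ ENNReal.ofReal κ * (normVInv V f * (ENNReal.ofReal (κ * D) * normVInv V f)) := by
        gcongr
        refine (lintegral_mul_le_normVInv_mul_normV hV hfV hvm).trans ?_
        gcongr
        exact (H _ hfV.conj).2.trans_eq (by rw [normVInv_conj])
    _ = (ENNReal.ofReal κ * ENNReal.ofReal (κ * D)) * normVInv V f ^ 2 := by ring
    _ = _ := by
        rw [mul_pow, ← ENNReal.ofReal_mul hκ.le, ← ENNReal.ofReal_pow (by positivity), mul_pow,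
          Real.sq_sqrt hD]
        congr 2; ring

end WeightedRestriction

/-! ### From the resolvent to the sphere. -/

namespace WeightedRestriction

open scoped ComplexConjugate FourierTransform RealInnerProductSpace

variable {n : ℕ} {κ r C : ℝ} {V : Rn n → ℂ}

lemma fourierInt_volume_eq (κ : ℝ) (f : Rn n → ℂ) (ξ : Rn n) :
    fourierInt κ volume f ξ = κ * 𝓕 f ((2 * Real.pi)⁻¹ • ξ) := by
  rw [fourierInt, Real.fourier_eq']
  congr 2
  ext x
  rw [smul_eq_mul, inner_smul_right]
  congr 2
  push_cast
  have : (Real.pi : ℂ) ≠ 0 := by exact_mod_cast Real.pi_ne_zero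
  field_simp

lemma continuous_fourier_of_integrable {f : Rn n → ℂ} (hf : Integrable f volume) :
    Continuous (𝓕 f) := by
  have := continuous_fourierInt 1 hf
  have h2 : 𝓕 f = fun ξ => fourierInt 1 volume f ((2 * Real.pi) • ξ) := by
    ext ξ
    rw [fourierInt_volume_eq, smul_smul, inv_mul_cancel₀ (by positivity)]
    simp
  rw [h2]
  fun_prop

/-- On `L¹ ∩ L²`, the `L²` Fourier transform is given by the Fourier integral. -/
lemma coeFn_fourier_toLp {f : Rn n → ℂ} (hf : Integrable f volume) (hf2 : MemLp f 2 volume) :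
    ((𝓕 (hf2.toLp f) : Lp (α := Rn n) ℂ 2 volume) : Rn n → ℂ) =ᵐ[volume] 𝓕 f := by
  refine ae_eq_of_integral_contDiff_smul_eq ((Lp.memLp _).locallyIntegrable one_le_two)
    (continuous_fourier_of_integrable hf).locallyIntegrable fun g hg hgc => ?_
  have hg₁ : HasCompactSupport (Complex.ofRealCLM ∘ g) := hgc.comp_left rfl
  have hg₂ : ContDiff ℝ (⊤ : ℕ∞) (Complex.ofRealCLM ∘ g) :=
    Complex.ofRealCLM.contDiff.comp hg
  -- As a Schwartz function, the test function can take over the distributional Fourier transform;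
  -- the multiplication formula for integrable functions then returns it to f.
  set G : 𝓢(Rn n, ℂ) := hg₁.toSchwartzMap hg₂
  have h1 : ∀ x, G x = g x := fun x => rfl
  calc ∫ x, g x • (𝓕 (hf2.toLp f) : Lp (α := Rn n) ℂ 2 volume) x
      = ((𝓕 (hf2.toLp f) : Lp (α := Rn n) ℂ 2 volume) : 𝓢'(Rn n, ℂ)) G := by
        rw [Lp.toTemperedDistribution_apply]
        simp [h1]
    _ = ∫ x, 𝓕 G x • (hf2.toLp f) x := by
        rw [← Lp.fourier_toTemperedDistribution_eq, TemperedDistribution.fourier_apply,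
          Lp.toTemperedDistribution_apply]
    _ = ∫ x, 𝓕 (G : Rn n → ℂ) x • f x := by
        refine integral_congr_ae ?_
        filter_upwards [hf2.coeFn_toLp] with x hx
        rw [hx, SchwartzMap.fourier_coe]
    _ = ∫ x, G x • 𝓕 f x := by
        simpa using! VectorFourier.integral_bilin_fourierIntegral_eq_flip
          (ContinuousLinearMap.lsmul ℂ ℂ) (L := innerₗ (Rn n))
          Real.continuous_fourierChar continuous_inner G.integrable hf
    _ = ∫ x, g x • 𝓕 f x := by simp [h1]

/-- The resolvent as a Fourier multiplier. -/
lemma exists_isFreeResolvent {z : ℂ} (hz : z.im ≠ 0) (f : Lp (α := Rn n) ℂ 2 volume) :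
    ∃ u : Lp (α := Rn n) ℂ 2 volume, IsFreeResolvent z f u ∧
      ((𝓕 u : Lp (α := Rn n) ℂ 2 volume) : Rn n → ℂ) =ᵐ[volume] fun ξ =>
        ((((2 * Real.pi) ^ 2 * ‖ξ‖ ^ 2 : ℝ) : ℂ) - z)⁻¹ *
          (𝓕 f : Lp (α := Rn n) ℂ 2 volume) ξ := by
  -- The symbol of -Δ - z when 𝓕 has phase e^{-2πi x·ξ}. Its modulus is at least |Im z|, so dividing
  -- by it preserves L².
  set p : Rn n → ℂ := fun ξ => (((2 * Real.pi) ^ 2 * ‖ξ‖ ^ 2 : ℝ) : ℂ) - z with hp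
  have him : ∀ ξ, |z.im| ≤ ‖p ξ‖ := fun ξ => by
    refine le_trans (le_of_eq ?_) (Complex.abs_im_le_norm _)
    rw [hp, Complex.sub_im, Complex.ofReal_im, zero_sub, abs_neg]
  have hp0 : ∀ ξ, p ξ ≠ 0 := fun ξ => norm_pos_iff.1 ((abs_pos.2 hz).trans_le (him ξ))
  have hpc : Continuous p := by fun_prop
  have hU : MemLp (fun ξ => (p ξ)⁻¹ * (𝓕 f : Lp (α := Rn n) ℂ 2 volume) ξ) 2 volume := by
    refine (Lp.memLp (𝓕 f : Lp (α := Rn n) ℂ 2 volume)).of_le_mul (c := |z.im|⁻¹) ?_ ?_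
    · exact (hpc.inv₀ hp0).aestronglyMeasurable.mul (Lp.aestronglyMeasurable _)
    · refine .of_forall fun ξ => ?_
      rw [norm_mul, norm_inv]
      gcongr
      exact him ξ
  have hsplit : 𝓕 (𝓕⁻ (hU.toLp _)) = hU.toLp _ := FourierTransform.fourier_fourierInv_eq _
  refine ⟨𝓕⁻ (hU.toLp _), ?_, ?_⟩
  · have hf : (f : 𝓢'(Rn n, ℂ)) =
        𝓕⁻ ((𝓕 f : Lp (α := Rn n) ℂ 2 volume) : 𝓢'(Rn n, ℂ)) := by
      rw [← Lp.fourier_toTemperedDistribution_eq, FourierTransform.fourierInv_fourier_eq]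
    rw [IsFreeResolvent, hf, ← Lp.fourierInv_toTemperedDistribution_eq,
      TemperedDistribution.laplacian_eq_fourierMultiplierCLM,
      TemperedDistribution.fourierMultiplierCLM_apply, FourierTransform.fourier_fourierInv_eq]
    have hq : (fun x : Rn n => Complex.ofReal (‖x‖ ^ 2)).HasTemperateGrowth := by fun_prop
    ext φ
    set ψ : 𝓢(Rn n, ℂ) := 𝓕⁻ φ
    have e1 : ∀ T : 𝓢'(Rn n, ℂ), (𝓕⁻ T : 𝓢'(Rn n, ℂ)) φ = T ψ := fun T => rfl
    set U := hU.toLp _ with hUdef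
    have i1 : ∀ χ : 𝓢(Rn n, ℂ), Integrable (fun x => χ x • U x) volume := fun χ =>
      MemLp.integrable_mul (χ.memLp 2 volume) (Lp.memLp U)
    have key : ((2 * (Real.pi : ℂ)) ^ 2 * ∫ x, (SchwartzMap.smulLeftCLM ℂ
          (fun x : Rn n => Complex.ofReal (‖x‖ ^ 2)) ψ) x • U x) -
        z * ∫ x, ψ x • U x = ∫ x, ψ x • (𝓕 f : Lp (α := Rn n) ℂ 2 volume) x := by
      rw [← integral_const_mul, ← integral_const_mul, ← integral_sub ((i1 _).const_mul _)
        ((i1 _).const_mul _)]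
      refine integral_congr_ae ?_
      filter_upwards [hU.coeFn_toLp] with x hx
      rw [hUdef, hx, SchwartzMap.smulLeftCLM_apply_apply hq]
      have := hp0 x
      simp only [smul_eq_mul]
      field_simp
      simp only [hp]
      push_cast
      ring
    have goal : -(-(2 * Real.pi) ^ 2 • (∫ x, (SchwartzMap.smulLeftCLM ℂ
          (fun x : Rn n => Complex.ofReal (‖x‖ ^ 2)) ψ) x • U x)) -
        z • ∫ x, ψ x • U x = ∫ x, ψ x • (𝓕 f : Lp (α := Rn n) ℂ 2 volume) x := by
      rw [← key, neg_smul, neg_neg, smul_eq_mul, Complex.real_smul]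
      push_cast
      rfl
    simpa [e1] using goal
  · rw [hsplit]
    exact hU.coeFn_toLp

/-- The resolvent estimate bounds the Poisson regularization of the spectral density. -/
lemma ResolventEstimate.lintegral_le (hV : AEMeasurable V volume) (hres : ResolventEstimate V C)
    {f : Rn n → ℂ} (hf : Integrable f volume) (hf2 : MemLp f 2 volume) (hfV : MemVInv V f)
    (l : ℝ) {ε : ℝ} (hε : 0 < ε) :
    ∫⁻ ξ, ENNReal.ofReal (ε / (((2 * Real.pi) ^ 2 * ‖ξ‖ ^ 2 - l) ^ 2 + ε ^ 2)) * ‖𝓕 f ξ‖ₑ ^ 2 ≤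
      ENNReal.ofReal C * normVInv V f ^ 2 := by
  set z : ℂ := ⟨l, ε⟩ with hz
  have hzim : z.im ≠ 0 := hε.ne'
  set F := hf2.toLp f
  have hFf : F =ᵐ[volume] f := hf2.coeFn_toLp
  obtain ⟨u, hu, hum⟩ := exists_isFreeResolvent hzim F
  have hnF : normVInv V F = normVInv V f := by
    unfold normVInv weightedNorm
    congr 1
    refine lintegral_congr_ae ?_
    filter_upwards [hFf] with x hx
    rw [hx]
  have hFV : MemVInv V F := ⟨Lp.aestronglyMeasurable F, hnF ▸ hfV.2⟩
  have hb := hres z hzim F u hFV hu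
  have h1 : ‖inner ℂ F u‖ₑ ≤ ENNReal.ofReal C * normVInv V f ^ 2 := by
    rw [L2.inner_def]
    calc _ ≤ ∫⁻ x, ‖inner ℂ (F x) (u x)‖ₑ := enorm_integral_le_lintegral_enorm _
      _ = ∫⁻ x, ‖F x‖ₑ * ‖u x‖ₑ := lintegral_congr fun x => by
          rw [RCLike.inner_apply, enorm_mul, RCLike.enorm_conj, mul_comm]
      _ ≤ normVInv V F * normV V u :=
          lintegral_mul_le_normVInv_mul_normV hV hFV (Lp.aestronglyMeasurable u)
      _ ≤ normVInv V F * (ENNReal.ofReal C * normVInv V F) := by gcongr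
      _ = _ := by rw [hnF]; ring
  refine le_trans ?_ h1
  rw [← Lp.inner_fourier_eq, L2.inner_def]
  have hint : Integrable (fun ξ => inner ℂ ((𝓕 F : Lp (α := Rn n) ℂ 2 volume) ξ)
    ((𝓕 u : Lp (α := Rn n) ℂ 2 volume) ξ)) volume := L2.integrable_inner _ _
  -- With a = (2π)²|ξ|² - l, the imaginary part of (a - iε)⁻¹ is ε/(a² + ε²).
  have him : (fun ξ => (inner ℂ ((𝓕 F : Lp (α := Rn n) ℂ 2 volume) ξ)
      ((𝓕 u : Lp (α := Rn n) ℂ 2 volume) ξ)).im) =ᵐ[volume] fun ξ =>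
      ε / (((2 * Real.pi) ^ 2 * ‖ξ‖ ^ 2 - l) ^ 2 + ε ^ 2) * ‖𝓕 f ξ‖ ^ 2 := by
    filter_upwards [hum, coeFn_fourier_toLp hf hf2] with ξ h2 h3
    rw [h2, h3, RCLike.inner_apply, mul_assoc, Complex.mul_conj, Complex.im_mul_ofReal,
      Complex.inv_im, Complex.normSq_eq_norm_sq (𝓕 f ξ), Complex.normSq_apply]
    simp only [Complex.sub_re, Complex.sub_im, Complex.ofReal_re, Complex.ofReal_im, hz]
    congr 2
    · ring
    · ring
  have him' : Integrable (fun ξ => (inner ℂ ((𝓕 F : Lp (α := Rn n) ℂ 2 volume) ξ)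
      ((𝓕 u : Lp (α := Rn n) ℂ 2 volume) ξ)).im) volume := hint.im
  calc _ = ∫⁻ ξ, ENNReal.ofReal
          (ε / (((2 * Real.pi) ^ 2 * ‖ξ‖ ^ 2 - l) ^ 2 + ε ^ 2) * ‖𝓕 f ξ‖ ^ 2) := by
        refine lintegral_congr fun ξ => ?_
        rw [ENNReal.ofReal_mul (by positivity), ENNReal.ofReal_pow (by positivity), ofReal_norm]
    _ = ENNReal.ofReal (∫ ξ, ε / (((2 * Real.pi) ^ 2 * ‖ξ‖ ^ 2 - l) ^ 2 + ε ^ 2) *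
          ‖𝓕 f ξ‖ ^ 2) :=
        (ofReal_integral_eq_lintegral_ofReal (him'.congr him)
          (.of_forall fun ξ => by positivity)).symm
    _ = ENNReal.ofReal (∫ ξ, inner ℂ ((𝓕 F : Lp (α := Rn n) ℂ 2 volume) ξ)
          ((𝓕 u : Lp (α := Rn n) ℂ 2 volume) ξ)).im := by
        rw [← integral_congr_ae him]
        congr 1
        exact integral_im hint
    _ ≤ _ := by
        rw [← ofReal_norm]
        exact ENNReal.ofReal_le_ofReal ((le_abs_self _).trans (Complex.abs_im_le_norm _))

/-- Integration in polar coordinates. -/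
lemma lintegral_eq_lintegral_toSphere {F : Rn n → ℝ≥0∞} (hn : 1 ≤ n) (hF : Measurable F) :
    ∫⁻ x, F x = ∫⁻ ω, (∫⁻ ρ in Set.Ioi (0 : ℝ),
      ENNReal.ofReal (ρ ^ (n - 1)) * F (ρ • (ω : Rn n))) ∂((volume : Measure (Rn n)).toSphere) := by
  have : Nonempty (Fin n) := ⟨⟨0, hn⟩⟩
  have hmp := (volume : Measure (Rn n)).measurePreserving_homeomorphUnitSphereProd
  rw [finrank_euclideanSpace_fin] at hmp
  calc ∫⁻ x, F x = ∫⁻ x : ({(0 : Rn n)}ᶜ : Set (Rn n)), F x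
          ∂((volume : Measure (Rn n)).comap (Subtype.val : ({(0 : Rn n)}ᶜ : Set (Rn n)) → Rn n)) := by
        rw [lintegral_subtype_comap (measurableSet_singleton _).compl F, restrict_compl_singleton]
    _ = ∫⁻ p, F ((p.2 : ℝ) • (p.1 : Rn n)) ∂((volume : Measure (Rn n)).toSphere.prod
          (Measure.volumeIoiPow (n - 1))) := by
        rw [← hmp.lintegral_comp_emb (Homeomorph.measurableEmbedding _)]
        refine lintegral_congr fun x => ?_
        have hx : ‖(x : Rn n)‖ ≠ 0 := norm_ne_zero_iff.2 x.2
        simp [smul_smul, hx]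
    _ = ∫⁻ ω, (∫⁻ ρ, F ((ρ : ℝ) • (ω : Rn n)) ∂(Measure.volumeIoiPow (n - 1)))
          ∂((volume : Measure (Rn n)).toSphere) :=
        lintegral_prod _ (by fun_prop)
    _ = _ := by
        refine lintegral_congr fun ω => ?_
        rw [Measure.volumeIoiPow, lintegral_withDensity_eq_lintegral_mul _ (by fun_prop)
          (by fun_prop)]
        exact lintegral_subtype_comap measurableSet_Ioi
          fun ρ : ℝ => ENNReal.ofReal (ρ ^ (n - 1)) * F (ρ • (ω : Rn n))

lemma lintegral_comp_add_mul (g : ℝ → ℝ≥0∞) (hg : Measurable g) (r : ℝ) {ε : ℝ} (hε : 0 < ε) :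
    ∫⁻ ρ, g ρ = ENNReal.ofReal ε * ∫⁻ t, g (r + ε * t) := by
  have h := Real.smul_map_volume_mul_left hε.ne'
  rw [← lintegral_add_left_eq_self g r]
  conv_lhs => rw [← h]
  rw [lintegral_smul_measure, lintegral_map (by fun_prop) (by fun_prop), abs_of_pos hε, smul_eq_mul]

/-- The mass of the rescaled Poisson kernel; 2r is the derivative of ρ² at ρ = r. -/
lemma lintegral_inv_one_add_sq (hr : 0 < r) :
    ∫⁻ t : ℝ, ENNReal.ofReal ((1 + (2 * r * t) ^ 2)⁻¹) = ENNReal.ofReal (Real.pi / (2 * r)) := by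
  have h2 : (2 * r) ≠ 0 := by positivity
  rw [← ofReal_integral_eq_lintegral_ofReal (integrable_inv_one_add_sq.comp_mul_left' h2)
    (.of_forall fun t => by positivity),
    Measure.integral_comp_mul_left (fun t : ℝ => (1 + t ^ 2)⁻¹), integral_univ_inv_one_add_sq,
    abs_of_pos (by positivity), smul_eq_mul, inv_mul_eq_div]

/-- A uniform bound for the Poisson regularizations of the measure `dσ_r` gives a bound
for `dσ_r`. -/
lemma lintegral_sphereMeasure_le (hn : 1 ≤ n) (hr : 0 < r) {Φ : Rn n → ℝ≥0∞} (hΦ : Continuous Φ)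
    (hΦt : ∀ ξ, Φ ξ ≠ ∞) {K : ℝ≥0∞}
    (h : ∀ ε : ℝ, 0 < ε →
      ∫⁻ ξ, ENNReal.ofReal (ε / ((‖ξ‖ ^ 2 - r ^ 2) ^ 2 + ε ^ 2)) * Φ ξ ≤ K) :
    ∫⁻ ξ, Φ ξ ∂(sphereMeasure n r) ≤ ENNReal.ofReal (2 * r / Real.pi) * K := by
  set σ := (volume : Measure (Rn n)).toSphere
  let ε : ℕ → ℝ := fun k => 1 / ((k : ℝ) + 1)
  have hε : ∀ k, 0 < ε k := fun k => by positivity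
  have hεlim : Tendsto ε atTop (𝓝 0) := tendsto_one_div_add_atTop_nhds_zero_nat
  let g : ℕ → Metric.sphere (0 : Rn n) 1 → ℝ → ℝ≥0∞ := fun k ω ρ =>
    ENNReal.ofReal (ρ ^ (n - 1)) *
      (ENNReal.ofReal (ε k / ((ρ ^ 2 - r ^ 2) ^ 2 + ε k ^ 2)) * Φ (ρ • (ω : Rn n)))
  -- The integrand after ρ = r + εt, with Jacobian ε. The indicator is needed because r + εt may be
  -- negative.
  let G : ℕ → Metric.sphere (0 : Rn n) 1 × ℝ → ℝ≥0∞ := fun k p =>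
    ENNReal.ofReal (ε k) * (Set.Ioi (0 : ℝ)).indicator (g k p.1) (r + ε k * p.2)
  have hΦm := hΦ.measurable
  have hgm : ∀ k, Measurable (Function.uncurry (g k)) := fun k => by
    simp only [g, Function.uncurry_def]
    fun_prop
  have hGm : ∀ k, Measurable (G k) := by
    intro k
    have : G k = fun p => ENNReal.ofReal (ε k) *
        ({p : Metric.sphere (0 : Rn n) 1 × ℝ | 0 < r + ε k * p.2}.indicator
          (fun p => Function.uncurry (g k) (p.1, r + ε k * p.2)) p) := by
      ext p
      simp only [G, Set.indicator, Set.mem_Ioi, Set.mem_ofPred_eq, Function.uncurry_apply_pair]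
    rw [this]
    refine Measurable.const_mul (Measurable.indicator ?_ ?_) _
    · exact (hgm k).comp (by fun_prop)
    · exact measurableSet_lt measurable_const (by fun_prop)
  have hGK : ∀ k, ∫⁻ p, G k p ∂(σ.prod volume) ≤ K := by
    intro k
    refine le_trans (le_of_eq ?_) (h (ε k) (hε k))
    rw [lintegral_eq_lintegral_toSphere hn (by fun_prop), lintegral_prod _ (hGm k).aemeasurable]
    refine lintegral_congr fun ω => ?_
    have hm : Measurable (g k ω) := (hgm k).comp (by fun_prop : Measurable fun ρ => (ω, ρ))
    rw [lintegral_const_mul' _ _ ENNReal.ofReal_ne_top,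
      ← lintegral_comp_add_mul _ (hm.indicator measurableSet_Ioi) r (hε k),
      lintegral_indicator measurableSet_Ioi]
    refine setLIntegral_congr_fun measurableSet_Ioi fun ρ hρ => ?_
    simp [g, norm_smul]
  have hlim : ∀ p, Tendsto (fun k => G k p) atTop (𝓝 (ENNReal.ofReal ((1 + (2 * r * p.2) ^ 2)⁻¹) *
      (ENNReal.ofReal (r ^ (n - 1)) * Φ (r • (p.1 : Rn n))))) := by
    rintro ⟨ω, t⟩
    have hρ : Tendsto (fun k => r + ε k * t) atTop (𝓝 r) := by
      simpa using tendsto_const_nhds.add (hεlim.mul_const t)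
    have h1 : Tendsto (fun k => ENNReal.ofReal ((1 + (t * (2 * r + ε k * t)) ^ 2)⁻¹)) atTop
        (𝓝 (ENNReal.ofReal ((1 + (2 * r * t) ^ 2)⁻¹))) := by
      refine (ENNReal.continuous_ofReal.tendsto _).comp ?_
      have hc : Continuous fun e : ℝ => (1 + (t * (2 * r + e * t)) ^ 2)⁻¹ :=
        Continuous.inv₀ (by fun_prop) fun e => by positivity
      have := (hc.tendsto 0).comp hεlim
      simpa [Function.comp_def, mul_comm t] using this
    have h2 : Tendsto (fun k => ENNReal.ofReal ((r + ε k * t) ^ (n - 1)) *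
        Φ ((r + ε k * t) • (ω : Rn n))) atTop
        (𝓝 (ENNReal.ofReal (r ^ (n - 1)) * Φ (r • (ω : Rn n)))) := by
      refine ENNReal.Tendsto.mul ?_ (Or.inr (hΦt _)) ?_ (Or.inr ENNReal.ofReal_ne_top)
      · exact (ENNReal.continuous_ofReal.tendsto _).comp (hρ.pow _)
      · exact (hΦ.tendsto _).comp (hρ.smul_const _)
    refine (ENNReal.Tendsto.mul h1 (Or.inr (by have := hΦt (r • (ω : Rn n)); finiteness)) h2
      (Or.inr ENNReal.ofReal_ne_top)).congr' ?_
    filter_upwards [hρ.eventually (lt_mem_nhds hr)] with k hk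
    simp only [G, g]
    rw [Set.indicator_of_mem (Set.mem_Ioi.2 hk)]
    -- Since ρ² - r² = εt(2r + εt), a factor ε² comes out of the denominator and the rescaled kernel
    -- has a finite limit.
    have he : (1 + (t * (2 * r + ε k * t)) ^ 2)⁻¹ =
        ε k * (ε k / (((r + ε k * t) ^ 2 - r ^ 2) ^ 2 + ε k ^ 2)) := by
      have := hε k
      have h3 : ((r + ε k * t) ^ 2 - r ^ 2) ^ 2 + ε k ^ 2 =
          ε k ^ 2 * (1 + (t * (2 * r + ε k * t)) ^ 2) := by ring
      rw [h3]
      field_simp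
    rw [he, ENNReal.ofReal_mul (hε k).le]
    ring
  have hfatou := lintegral_le_of_tendsto_of_forall_le (fun k => (hGm k).aemeasurable) hlim hGK
  rw [lintegral_prod _ (by fun_prop)] at hfatou
  have hin : ∀ ω : Metric.sphere (0 : Rn n) 1, ∫⁻ t : ℝ, ENNReal.ofReal ((1 + (2 * r * t) ^ 2)⁻¹) *
      (ENNReal.ofReal (r ^ (n - 1)) * Φ (r • (ω : Rn n))) =
      ENNReal.ofReal (Real.pi / (2 * r)) * (ENNReal.ofReal (r ^ (n - 1)) * Φ (r • (ω : Rn n))) := by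
    intro ω
    rw [lintegral_mul_const _ (by fun_prop), lintegral_inv_one_add_sq hr]
  simp only [hin] at hfatou
  rw [lintegral_const_mul' _ _ ENNReal.ofReal_ne_top, lintegral_const_mul' _ _ ENNReal.ofReal_ne_top,
    ← lintegral_sphereMeasure r hΦm] at hfatou
  calc _ = ENNReal.ofReal (2 * r / Real.pi) *
        (ENNReal.ofReal (Real.pi / (2 * r)) * ∫⁻ ξ, Φ ξ ∂(sphereMeasure n r)) := by
        rw [← mul_assoc, ← ENNReal.ofReal_mul (by positivity)]
        have : 2 * r / Real.pi * (Real.pi / (2 * r)) = 1 := by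
          have := Real.pi_pos
          field_simp
        rw [this]; simp
    _ ≤ _ := by gcongr

/-- The resolvent estimate implies the restriction estimate on `L¹ ∩ L²`. -/
lemma ResolventEstimate.integrableRestrictionEstimate (hn : 1 ≤ n) (hκ : 0 < κ) (hr : 0 < r)
    (hC : 0 ≤ C) (hV : AEMeasurable V volume) (hres : ResolventEstimate V C) :
    IntegrableRestrictionEstimate κ V r
      (κ * √(2 * (2 * Real.pi) ^ n / Real.pi * (r * C))) := by
  intro f hf hf2 hfV
  have hpi := Real.pi_pos
  have hf' := continuous_fourier_of_integrable hf
  have hm : Measurable (𝓕 f) := hf'.measurable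
  have hc : Continuous fun ξ : Rn n => 𝓕 f ((2 * Real.pi)⁻¹ • ξ) := hf'.comp (by fun_prop)
  -- Rescaling the frequency from e^{-2πi x·ξ} to e^{-i x·ξ} has Jacobian (2π)ⁿ; with the factor
  -- 2r/π this produces c_n r.
  have hmap := Measure.map_addHaar_smul (volume : Measure (Rn n)) (r := (2 * Real.pi)⁻¹)
    (by positivity)
  rw [finrank_euclideanSpace_fin, inv_pow, inv_inv, abs_of_pos (by positivity)] at hmap
  have hΦ := lintegral_sphereMeasure_le hn hr
    (Φ := fun ξ => ‖𝓕 f ((2 * Real.pi)⁻¹ • ξ)‖ₑ ^ 2) ((ENNReal.continuous_pow 2).comp hc.enorm) (fun ξ => by finiteness)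
    (K := ENNReal.ofReal ((2 * Real.pi) ^ n) * (ENNReal.ofReal C * normVInv V f ^ 2)) (by
      intro ε hε
      have h1 := hres.lintegral_le hV hf hf2 hfV (r ^ 2) hε
      let Ψ : Rn n → ℝ≥0∞ := fun η => ENNReal.ofReal
        (ε / (((2 * Real.pi) ^ 2 * ‖η‖ ^ 2 - r ^ 2) ^ 2 + ε ^ 2)) * ‖𝓕 f η‖ₑ ^ 2
      have hΨ : Measurable Ψ := by fun_prop
      calc _ = ∫⁻ ξ : Rn n, Ψ ((2 * Real.pi)⁻¹ • ξ) := by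
            refine lintegral_congr fun ξ => ?_
            simp only [Ψ, norm_smul, norm_inv,
              Real.norm_of_nonneg (show 0 ≤ 2 * Real.pi by positivity)]
            have : (2 * Real.pi) ^ 2 * ((2 * Real.pi)⁻¹ * ‖ξ‖) ^ 2 = ‖ξ‖ ^ 2 := by field_simp
            rw [this]
        _ = ENNReal.ofReal ((2 * Real.pi) ^ n) * ∫⁻ η : Rn n, Ψ η := by
            rw [← lintegral_map hΨ (measurable_const_smul _), hmap, lintegral_smul_measure,
              smul_eq_mul]
        _ ≤ _ := by gcongr)
  rw [← ENNReal.pow_le_pow_left_iff two_ne_zero, eLpNorm_two_sq]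
  have hpt : ∀ ξ, ‖fourierInt κ volume f ξ‖ₑ ^ 2 =
      ENNReal.ofReal (κ ^ 2) * ‖𝓕 f ((2 * Real.pi)⁻¹ • ξ)‖ₑ ^ 2 := fun ξ => by
    rw [fourierInt_volume_eq, enorm_mul, mul_pow, ← ofReal_norm (κ : ℂ), Complex.norm_real,
      Real.norm_of_nonneg hκ.le, ENNReal.ofReal_pow hκ.le]
  simp only [hpt]
  rw [lintegral_const_mul' _ _ ENNReal.ofReal_ne_top]
  calc _ ≤ ENNReal.ofReal (κ ^ 2) * (ENNReal.ofReal (2 * r / Real.pi) *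
        (ENNReal.ofReal ((2 * Real.pi) ^ n) * (ENNReal.ofReal C * normVInv V f ^ 2))) := by gcongr
    _ = _ := by
        rw [mul_pow (ENNReal.ofReal _), ← ENNReal.ofReal_pow (by positivity), mul_pow κ,
          Real.sq_sqrt (by positivity)]
        simp only [← mul_assoc]
        rw [← ENNReal.ofReal_mul (by positivity), ← ENNReal.ofReal_mul (by positivity),
          ← ENNReal.ofReal_mul (by positivity)]
        congr 2
        ring

/-! ### Constants and conclusion. -/

lemma ConvolutionEstimate.mono {A B : ℝ} (hAB : A ≤ B) (H : ConvolutionEstimate κ V r A) :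
    ConvolutionEstimate κ V r B := fun f hf =>
  ⟨(H f hf).1, (H f hf).2.trans (by gcongr)⟩

lemma RestrictionEstimate.mono {A B : ℝ} (hAB : A ≤ B) (H : RestrictionEstimate κ V r A) :
    RestrictionEstimate κ V r B := fun f hf => by
  obtain ⟨g, h1, h2, h3⟩ := H f hf
  exact ⟨g, h1, h2, h3.trans (by gcongr)⟩

lemma ExtensionEstimate.mono {A B : ℝ} (hAB : A ≤ B) (H : ExtensionEstimate κ V r A) :
    ExtensionEstimate κ V r B := fun f hf =>
  (H f hf).trans (by gcongr)

/-- The first bound uses 2/π ≤ 1 and suffices for convolution. The squares of the other two bounds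
contain κ², so the extra factor κ ≤ 1 is needed there. -/
lemma normalization_le (hκ : 0 < κ) (hκn : κ ≤ ((2 * Real.pi) ^ n)⁻¹) :
    κ * (2 * (2 * Real.pi) ^ n / Real.pi) ≤ 1 ∧ κ ≤ 1 := by
  have hpi := Real.pi_gt_three
  have h1 : κ * (2 * Real.pi) ^ n ≤ 1 := by
    rwa [← le_div_iff₀ (by positivity), one_div]
  have h2 : (1 : ℝ) ≤ (2 * Real.pi) ^ n := one_le_pow₀ (by linarith)
  constructor
  · calc κ * (2 * (2 * Real.pi) ^ n / Real.pi) = (κ * (2 * Real.pi) ^ n) * (2 / Real.pi) := by ring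
      _ ≤ 1 * 1 := by
        gcongr
        rw [div_le_one (by positivity)]; linarith
      _ = 1 := one_mul _
  · nlinarith

end WeightedRestriction

theorem mainTheorem11 (n : ℕ) (hn : 2 ≤ n) (V : WeightedRestriction.Rn n → ℂ)
    (hV : AEMeasurable V volume) (C : ℝ) (hC : 0 ≤ C)
    (hres : WeightedRestriction.ResolventEstimate V C)
    (κ : ℝ) (hκ : 0 < κ) (r : ℝ) (hr : 0 < r) :
    -- the three estimates, for the Fourier transform with normalizing factor `κ`
    (WeightedRestriction.ConvolutionEstimate κ V r
        (κ * (2 * (2 * Real.pi) ^ n / Real.pi * (r * C))) ∧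
      WeightedRestriction.RestrictionEstimate κ V r
        (κ * √(2 * (2 * Real.pi) ^ n / Real.pi * (r * C))) ∧
      WeightedRestriction.ExtensionEstimate κ V r
        (κ * √(2 * (2 * Real.pi) ^ n / Real.pi * (r * C)))) ∧
    -- the bounds `r C` and `r^{1/2} C^{1/2}` for the normalizing factor `(2π)⁻ⁿ`, or a smaller one
    (κ ≤ ((2 * Real.pi) ^ n)⁻¹ →
      WeightedRestriction.ConvolutionEstimate κ V r (r * C) ∧
      WeightedRestriction.RestrictionEstimate κ V r (√r * √C) ∧
      WeightedRestriction.ExtensionEstimate κ V r (√r * √C)) ∧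
    -- the three estimates are equivalent, with corresponding bounds
    (∀ D : ℝ, 0 ≤ D →
      List.TFAE
        [WeightedRestriction.ConvolutionEstimate κ V r (κ * D),
          WeightedRestriction.RestrictionEstimate κ V r (κ * √D),
          WeightedRestriction.ExtensionEstimate κ V r (κ * √D)]) := by
  have hn1 : 1 ≤ n := by omega
  have hD0 : 0 ≤ 2 * (2 * Real.pi) ^ n / Real.pi * (r * C) := by
    have := Real.pi_pos
    positivity
  have hext := (hres.integrableRestrictionEstimate hn1 hκ hr hC hV).extensionEstimate hV
  have hrest := hext.restrictionEstimate hn1 hκ hr hV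
  have hconv := hext.convolutionEstimate hn1 hκ hr hD0 hV
  refine ⟨⟨hconv, hrest, hext⟩, fun hκn => ?_, fun D hD => ?_⟩
  · obtain ⟨h1, h2⟩ := WeightedRestriction.normalization_le hκ hκn
    have hA : κ * (2 * (2 * Real.pi) ^ n / Real.pi * (r * C)) ≤ r * C := by
      rw [← mul_assoc]
      exact mul_le_of_le_one_left (by positivity) h1
    have hB : κ * √(2 * (2 * Real.pi) ^ n / Real.pi * (r * C)) ≤ √r * √C := by
      rw [← Real.sqrt_mul hr.le]
      refine Real.le_sqrt_of_sq_le ?_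
      rw [mul_pow, Real.sq_sqrt hD0, sq, mul_assoc]
      exact (mul_le_of_le_one_left (mul_nonneg hκ.le hD0) h2).trans hA
    exact ⟨hconv.mono hA, hrest.mono hB, hext.mono hB⟩
  · tfae_have 1 → 3 := fun h => (h.integrableRestrictionEstimate hκ hD hV).extensionEstimate hV
    tfae_have 2 → 3 := fun h => h.integrableRestrictionEstimate.extensionEstimate hV
    tfae_have 3 → 1 := fun h => h.convolutionEstimate hn1 hκ hr hD hV
    tfae_have 3 → 2 := fun h => h.restrictionEstimate hn1 hκ hr hV
    tfae_finish
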